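/- Let $\Omega\subseteq\mathbb C^m$ be bounded, open and connected, and let $\mathcal A(\Omega)$ be the completion, in the supremum norm on $\overline\Omega$, of the algebra of functions holomorphic in a neighbourhood of $\overline\Omega$. Let $\mathcal Z\subseteq\Omega$ be a connected smooth complex hypersurface: near each of its points it is the zero set of a holomorphic function $\varphi$ with $d\varphi\neq0$ on $\mathcal Z$. Let $\mathcal M$ and $\tilde{\mathcal M}$ be quasi-free Hilbert modules of rank $1$ over $\mathcal A(\Omega)$. That is, each is a Hilbert space completion of $\mathcal A(\Omega)$ for which (1) the evaluations at points of $\Omega$ are locally uniformly bounded, (2) multiplication by each $f\in\mathcal A(\Omega)$ is bounded, and (3) a sequence in $\mathcal A(\Omega)$ that is Cauchy in the norm of the module converges to $0$ in norm if and only if it converges to $0$ at every point of $\Omega$. The elements of such a module are holomorphic functions on $\Omega$. Let $K,\tilde K$ be the reproducing kernels, and write $h(z)=K(z,z)$, $\tilde h(z)=\tilde K(z,z)$ for the hermitian metrics of the associated line bundles $E,\tilde E$. Let $\mathcal M_0\subseteq\mathcal M$ be the submodule of the functions vanishing to order $2$ on $\mathcal Z$ (that is, locally of the form $\varphi^2g$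 with $g$ holomorphic), and let $\mathcal Q=\mathcal M\ominus\mathcal M_0$ with the compressed module action $f\cdot(x+\mathcal M_0)=fx+\mathcal M_0$. Define $\tilde{\mathcal Q}=\tilde{\mathcal M}\ominus\tilde{\mathcal M}_0$ likewise. Near each $p\in\mathcal Z$ fix a normal direction: a holomorphic vector field $\nu$ near $p$ with $\nu(p)\notin T_p\mathcal Z$ (for example $\partial/\partial z_1$ if $\mathcal Z=\{z_1=0\}$). Write $\mathcal K(u,v)=\bar\partial_u(h^{-1}\partial_v h)$ for the coefficients of the curvature $\mathcal K=\bar\partial(h^{-1}\partial h)$. At $p\in\mathcal Z$ define the tangential curvature $\mathcal K_{\rm tan}=\mathcal K|_{T_p\mathcal Z\times T_p\mathcal Z}$, the transverse curvature $\mathcal K_{\rm trans}=\mathcal K(\nu,\nu)$, and the off-diagonal coefficients $\mathcal S=\mathcal K(\nu,\cdot)|_{T_p\mathcal Z}$. Further, let $J^{(2)}E$ be the jet bundle with holomorphic frame $(s,\partial_\nu s)$, where $s$ is a holomorphic frame of $E$ with $\langle s,s\rangle=h$, and with metric $$\begin{pmatrix}h&\partial_\nu h\\ \bar\partial_\nu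 h&\bar\partial_\nu\partial_\nu h\end{pmatrix}.$$ Let $D$ be its canonical (Chern) connection and $(e_1,e_2)$ the orthonormal frame obtained from $(s,\partial_\nu s)$ by the Gram–Schmidt process. The second fundamental form of the inclusion $E\subseteq J^{(2)}E$ is the one-form $\mathbb I=\langle De_2,e_1\rangle$. Define $\tilde{\mathcal K}_{\rm tan},\tilde{\mathcal K}_{\rm trans},\tilde{\mathcal S},\tilde{\mathbb I}$ in the same way from $\tilde h$, with the same $\nu$. Then $\mathcal Q$ and $\tilde{\mathcal Q}$ are isomorphic (there is a unitary module map between them) if and only if $$\mathcal K_{\rm tan}=\tilde{\mathcal K}_{\rm tan},\qquad \mathcal K_{\rm trans}=\tilde{\mathcal K}_{\rm trans},\qquad \mathcal S=\tilde{\mathcal S}\qquad\text{on }\mathcal Z.$$ Equivalently, they are isomorphic if and only if $\mathcal K_{\rm tan}=\tilde{\mathcal K}_{\rm tan}$, $\mathcal K_{\rm trans}=\tilde{\mathcal K}_{\rm trans}$ and $\mathbb I=\tilde{\mathbb I}$ on $\mathcal Z$. -/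

import Mathlib

open Set Filter Topology

noncomputable section

/-! ### Function algebra -/

/-- Functions on `closure Ω` that are restrictions of functions holomorphic (locally given by
convergent power series) in a neighbourhood of `closure Ω`. -/
def holoNearClosure {m : ℕ} (Ω : Set (EuclideanSpace ℂ (Fin m))) :
    Subalgebra ℂ C(closure Ω, ℂ) where
  carrier := {f | ∃ (U : Set (EuclideanSpace ℂ (Fin m))) (F : EuclideanSpace ℂ (Fin m) → ℂ),
    IsOpen U ∧ closure Ω ⊆ U ∧ AnalyticOnNhd ℂ F U ∧ ∀ w : closure Ω, f w = F w}
  mul_mem' := by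
    rintro f g ⟨U, F, hU, hΩU, hF, hfF⟩ ⟨V, G, hV, hΩV, hG, hgG⟩
    refine ⟨U ∩ V, F * G, hU.inter hV, subset_inter hΩU hΩV,
      (hF.mono inter_subset_left).mul (hG.mono inter_subset_right), fun w => ?_⟩
    simp [hfF, hgG]
  add_mem' := by
    rintro f g ⟨U, F, hU, hΩU, hF, hfF⟩ ⟨V, G, hV, hΩV, hG, hgG⟩
    refine ⟨U ∩ V, F + G, hU.inter hV, subset_inter hΩU hΩV,
      (hF.mono inter_subset_left).add (hG.mono inter_subset_right), fun w => ?_⟩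
    simp [hfF, hgG]
  algebraMap_mem' := by
    intro c
    exact ⟨univ, fun _ => c, isOpen_univ, subset_univ _, analyticOnNhd_const, fun w => rfl⟩

instance {m : ℕ} (Ω : Set (EuclideanSpace ℂ (Fin m))) : LocallyCompactSpace (closure Ω) :=
  isClosed_closure.isClosedEmbedding_subtypeVal.locallyCompactSpace

/-- The algebra `𝒜(Ω)`: the closure, in the continuous functions on `closure Ω`, of the functions
holomorphic in a neighbourhood of `closure Ω`. (For bounded `Ω` the set `closure Ω` is compact and
the topology of `C(closure Ω, ℂ)` is that of the supremum norm.) -/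
def AlgA {m : ℕ} (Ω : Set (EuclideanSpace ℂ (Fin m))) : Type :=
  (holoNearClosure Ω).topologicalClosure

instance {m : ℕ} (Ω : Set (EuclideanSpace ℂ (Fin m))) : CommRing (AlgA Ω) :=
  inferInstanceAs (CommRing (holoNearClosure Ω).topologicalClosure)

instance {m : ℕ} (Ω : Set (EuclideanSpace ℂ (Fin m))) : Algebra ℂ (AlgA Ω) :=
  inferInstanceAs (Algebra ℂ (holoNearClosure Ω).topologicalClosure)

/-- Evaluation of `f ∈ 𝒜(Ω)` at a point `w` (with value `0` off `closure Ω`). -/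
def evalA {m : ℕ} (Ω : Set (EuclideanSpace ℂ (Fin m))) (w : EuclideanSpace ℂ (Fin m)) :
    AlgA Ω →ₗ[ℂ] ℂ :=
  open Classical in
  if hw : w ∈ closure Ω then
    { toFun := fun f => f.1 ⟨w, hw⟩
      map_add' := fun _ _ => rfl
      map_smul' := fun _ _ => rfl }
  else 0

/-! ### Quasi-free Hilbert modules of rank one -/

/-- A Hilbert space `H` presented as a quasi-free Hilbert module of rank one over `𝒜(Ω)`: it is a
completion of `𝒜(Ω)` (via the injection `emb` with dense range) such that evaluations at the points
of `Ω` are locally uniformly bounded, multiplications by elements of `𝒜(Ω)` are bounded, and a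
sequence in `𝒜(Ω)` that is Cauchy in `H` converges to `0` in `H` iff it does so pointwise on `Ω`. -/
structure QuasiFree {m : ℕ} (Ω : Set (EuclideanSpace ℂ (Fin m)))
    (H : Type*) [NormedAddCommGroup H] [InnerProductSpace ℂ H] [CompleteSpace H] where
  emb : AlgA Ω →ₗ[ℂ] H
  emb_injective : Function.Injective emb
  emb_dense : DenseRange emb
  eval_bounded : ∀ w ∈ Ω, ∃ V ∈ 𝓝 w, ∃ C : ℝ, ∀ z ∈ V ∩ Ω, ∀ f : AlgA Ω,
    ‖evalA Ω z f‖ ≤ C * ‖emb f‖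
  mul_bounded : ∀ f : AlgA Ω, ∃ C : ℝ, ∀ g : AlgA Ω, ‖emb (f * g)‖ ≤ C * ‖emb g‖
  tendsto_zero_iff : ∀ f : ℕ → AlgA Ω, CauchySeq (fun n => emb (f n)) →
    (Tendsto (fun n => emb (f n)) atTop (𝓝 0) ↔
      ∀ w ∈ Ω, Tendsto (fun n => evalA Ω w (f n)) atTop (𝓝 0))

namespace QuasiFree

variable {m : ℕ} {Ω : Set (EuclideanSpace ℂ (Fin m))}
  {H : Type*} [NormedAddCommGroup H] [InnerProductSpace ℂ H] [CompleteSpace H]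

/-- The bounded extension to `H` of the evaluation at `w ∈ Ω`; an element `x` of `H` is thereby the
function `w ↦ M.eval w x` on `Ω`. -/
def eval (M : QuasiFree Ω H) (w : EuclideanSpace ℂ (Fin m)) : H →L[ℂ] ℂ :=
  LinearMap.extendOfNorm (evalA Ω w) M.emb

theorem eval_emb (M : QuasiFree Ω H) {w : EuclideanSpace ℂ (Fin m)} (hw : w ∈ Ω) (f : AlgA Ω) :
    M.eval w (M.emb f) = evalA Ω w f := by
  obtain ⟨V, hV, C, hC⟩ := M.eval_bounded w hw
  exact LinearMap.extendOfNorm_eq M.emb_dense ⟨C, hC w ⟨mem_of_mem_nhds hV, hw⟩⟩ f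

/-- The module action: the bounded extension to `H` of the multiplication by `f` on `𝒜(Ω)`. -/
def act (M : QuasiFree Ω H) (f : AlgA Ω) : H →L[ℂ] H :=
  LinearMap.extendOfNorm (M.emb ∘ₗ LinearMap.mulLeft ℂ f) M.emb

theorem act_emb (M : QuasiFree Ω H) (f g : AlgA Ω) : M.act f (M.emb g) = M.emb (f * g) :=
  LinearMap.extendOfNorm_eq M.emb_dense (M.mul_bounded f) g

/-- The reproducing kernel `K(z, w) = e_z e_w^*`. -/
def kernel (M : QuasiFree Ω H) (z w : EuclideanSpace ℂ (Fin m)) : ℂ :=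
  M.eval z (ContinuousLinearMap.adjoint (M.eval w) 1)

/-- The hermitian metric `ϱ(w) = K(w, w)` of the line bundle of `M`, in its canonical frame. -/
def metric (M : QuasiFree Ω H) (w : EuclideanSpace ℂ (Fin m)) : ℂ := M.kernel w w

end QuasiFree

/-! ### Hypersurfaces, order of vanishing, quotient modules -/

/-- `φ` is a defining function of `Z` on the open set `U ⊆ Ω`: it is holomorphic on `U`, its zero
set in `U` is `U ∩ Z`, and its differential does not vanish at the points of `U ∩ Z`. -/
structure IsDefiningFunction {m : ℕ} (Ω Z : Set (EuclideanSpace ℂ (Fin m)))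
    (U : Set (EuclideanSpace ℂ (Fin m))) (φ : EuclideanSpace ℂ (Fin m) → ℂ) : Prop where
  isOpen : IsOpen U
  subset : U ⊆ Ω
  holo : AnalyticOnNhd ℂ φ U
  zero_iff : ∀ z ∈ U, φ z = 0 ↔ z ∈ Z
  fderiv_ne_zero : ∀ z ∈ U ∩ Z, fderiv ℂ φ z ≠ 0

/-- `Z ⊆ Ω` is a (smooth, complex) hypersurface. -/
def IsHypersurface {m : ℕ} (Ω Z : Set (EuclideanSpace ℂ (Fin m))) : Prop :=
  Z ⊆ Ω ∧ ∀ p ∈ Z, ∃ U φ, IsDefiningFunction Ω Z U φ ∧ p ∈ U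

/-- The holomorphic tangent space `T_p Z`, the kernel of `dφ_p` for the local defining functions
`φ` of `Z` at `p`. -/
def tangentZ {m : ℕ} (Ω Z : Set (EuclideanSpace ℂ (Fin m))) (p : EuclideanSpace ℂ (Fin m)) :
    Submodule ℂ (EuclideanSpace ℂ (Fin m)) where
  carrier := {v | ∀ U φ, IsDefiningFunction Ω Z U φ → p ∈ U → fderiv ℂ φ p v = 0}
  add_mem' := by
    intro a b ha hb U φ h hp
    rw [map_add, ha U φ h hp, hb U φ h hp, add_zero]
  zero_mem' := by
    intro U φ _ _
    exact map_zero _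
  smul_mem' := by
    intro c a ha U φ h hp
    rw [map_smul, ha U φ h hp, smul_zero]

namespace QuasiFree

variable {m : ℕ} {Ω : Set (EuclideanSpace ℂ (Fin m))}
  {H : Type*} [NormedAddCommGroup H] [InnerProductSpace ℂ H] [CompleteSpace H]

/-- `ℳ₀`: the elements of `M` that, as functions on `Ω`, vanish to order `k` on `Z`, i.e. are of the
form `φ ^ k * g` with `g` holomorphic, for the local defining functions `φ` of `Z`. -/
def vanishing (M : QuasiFree Ω H) (Z : Set (EuclideanSpace ℂ (Fin m))) (k : ℕ) :
    Submodule ℂ H where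
  carrier := {x | ∀ U φ, IsDefiningFunction Ω Z U φ →
    ∃ g : EuclideanSpace ℂ (Fin m) → ℂ, AnalyticOnNhd ℂ g U ∧
      ∀ z ∈ U, M.eval z x = φ z ^ k * g z}
  add_mem' := by
    intro a b ha hb U φ h
    obtain ⟨g, hg, hg'⟩ := ha U φ h
    obtain ⟨g₂, hg₂, hg₂'⟩ := hb U φ h
    exact ⟨g + g₂, hg.add hg₂, fun z hz => by
      rw [map_add, hg' z hz, hg₂' z hz, Pi.add_apply, mul_add]⟩
  zero_mem' := by
    intro U φ _
    exact ⟨0, analyticOnNhd_const, fun z _ => by simp⟩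
  smul_mem' := by
    intro c a ha U φ h
    obtain ⟨g, hg, hg'⟩ := ha U φ h
    exact ⟨fun z => c * g z, analyticOnNhd_const.mul hg, fun z hz => by
      rw [map_smul, hg' z hz, smul_eq_mul, mul_left_comm]⟩

/-- The quotient module `𝒬 = ℳ ⊖ ℳ₀`, for the functions vanishing to order `2` on `Z`. -/
abbrev quot (M : QuasiFree Ω H) (Z : Set (EuclideanSpace ℂ (Fin m))) : Submodule ℂ H :=
  (M.vanishing Z 2)ᗮ

/-- The module action on `ℳ ⊖ ℳ₀`, i.e. `f · (x + ℳ₀) = f · x + ℳ₀`: the compression of the action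
on `ℳ`. -/
def quotAct (M : QuasiFree Ω H) (Z : Set (EuclideanSpace ℂ (Fin m))) (f : AlgA Ω) :
    M.quot Z →L[ℂ] M.quot Z :=
  (M.quot Z).orthogonalProjectionOnto ∘L M.act f ∘L (M.quot Z).subtypeL

/-- Isomorphism of the quotient Hilbert modules: a unitary module map. -/
def QuotIso {H' : Type*} [NormedAddCommGroup H'] [InnerProductSpace ℂ H'] [CompleteSpace H']
    (M : QuasiFree Ω H) (M' : QuasiFree Ω H') (Z : Set (EuclideanSpace ℂ (Fin m))) : Prop :=
  ∃ T : M.quot Z ≃ₗᵢ[ℂ] M'.quot Z,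
    ∀ (f : AlgA Ω) (x : M.quot Z), T (M.quotAct Z f x) = M'.quotAct Z f (T x)

end QuasiFree

/-! ### Hermitian geometry -/

/-- The `(1,0)` derivative `∂_v f = (df(v) - i df(iv)) / 2`; for `v` the `j`-th unit vector it is
`∂f/∂z_j`. -/
def dHol {E F : Type*} [NormedAddCommGroup E] [NormedSpace ℂ E] [NormedAddCommGroup F]
    [NormedSpace ℂ F] (f : E → F) (z v : E) : F :=
  (2⁻¹ : ℂ) • (fderiv ℝ f z v - Complex.I • fderiv ℝ f z (Complex.I • v))

/-- The `(0,1)` derivative `∂̄_v f = (df(v) + i df(iv)) / 2`; for `v` the `j`-th unit vector it is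
`∂f/∂z̄_j`. -/
def dBar {E F : Type*} [NormedAddCommGroup E] [NormedSpace ℂ E] [NormedAddCommGroup F]
    [NormedSpace ℂ F] (f : E → F) (z v : E) : F :=
  (2⁻¹ : ℂ) • (fderiv ℝ f z v + Complex.I • fderiv ℝ f z (Complex.I • v))

/-- The curvature `𝒦 = ∂̄ (h⁻¹ ∂ h)` of a hermitian holomorphic line bundle with metric `h` in a
holomorphic frame: `curvature h z u v` is the coefficient `∂̄_u (h⁻¹ ∂_v h)`, which is `𝒦_ij` (the
coefficient of `dz̄_i ∧ dz_j`) when `u`, `v` are the `i`-th and `j`-th unit vectors. -/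
def curvature {m : ℕ} (h : EuclideanSpace ℂ (Fin m) → ℂ) (z u v : EuclideanSpace ℂ (Fin m)) : ℂ :=
  dBar (fun w => (h w)⁻¹ * dHol h w v) z u

/-- Tangential curvature at `p ∈ Z`. -/
def curvTan {m : ℕ} (Ω Z : Set (EuclideanSpace ℂ (Fin m))) (h : EuclideanSpace ℂ (Fin m) → ℂ)
    (p : EuclideanSpace ℂ (Fin m)) : tangentZ Ω Z p → tangentZ Ω Z p → ℂ :=
  fun u v => curvature h p u v

/-- Transverse curvature at `p`, for the normal direction `n`. -/
def curvTrans {m : ℕ} (h : EuclideanSpace ℂ (Fin m) → ℂ) (p n : EuclideanSpace ℂ (Fin m)) : ℂ :=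
  curvature h p n n

/-- The off-diagonal curvature coefficients `𝒮` (`𝒦_1j` with `j ≥ 2`, if `n` is the first and the
other unit vectors are tangent to `Z`) at `p ∈ Z`, for the normal direction `n`. -/
def curvOff {m : ℕ} (Ω Z : Set (EuclideanSpace ℂ (Fin m))) (h : EuclideanSpace ℂ (Fin m) → ℂ)
    (p n : EuclideanSpace ℂ (Fin m)) : tangentZ Ω Z p → ℂ :=
  fun v => curvature h p n v

/-- The metric of the second order jet bundle `J^(2) E` in the holomorphic frame `(s, ∂_ν s)`, where
`ν` is a holomorphic vector field and `h = ⟨s, s⟩`. The `(i, j)` entry is `⟨s_j, s_i⟩`. -/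
def jetMetric {m : ℕ} (ν : EuclideanSpace ℂ (Fin m) → EuclideanSpace ℂ (Fin m))
    (h : EuclideanSpace ℂ (Fin m) → ℂ) (z : EuclideanSpace ℂ (Fin m)) : Matrix (Fin 2) (Fin 2) ℂ :=
  !![h z, dHol h z (ν z);
     dBar h z (ν z), dBar (fun w => dHol h w (ν w)) z (ν z)]

/-- The hermitian inner product `⟨a, b⟩` (linear in `a`) of two vectors with coefficients `a`, `b`
in a frame `s` whose Gram matrix `(⟨s_j, s_i⟩)_ij` is `N`. -/
def fiberInner (N : Matrix (Fin 2) (Fin 2) ℂ) (a b : Fin 2 → ℂ) : ℂ :=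
  star b ⬝ᵥ N.mulVec a

/-- The norm of the vector with coefficients `a`. -/
def fiberNorm (N : Matrix (Fin 2) (Fin 2) ℂ) (a : Fin 2 → ℂ) : ℝ :=
  Real.sqrt (fiberInner N a a).re

/-- First and second vector of the orthonormal frame which the Gram-Schmidt process yields from the
frame `s`. -/
def gramSchmidt₁ (N : Matrix (Fin 2) (Fin 2) ℂ) : Fin 2 → ℂ :=
  ((fiberNorm N ![1, 0])⁻¹ : ℂ) • ![1, 0]

/-- See `gramSchmidt₁`. -/
def gramSchmidt₂ (N : Matrix (Fin 2) (Fin 2) ℂ) : Fin 2 → ℂ :=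
  let x : Fin 2 → ℂ := ![0, 1] - fiberInner N ![0, 1] (gramSchmidt₁ N) • gramSchmidt₁ N
  ((fiberNorm N x)⁻¹ : ℂ) • x

/-- The canonical connection `D = D^{1,0} + D^{0,1}` of a hermitian holomorphic bundle of rank two
with Gram matrix `N` in a holomorphic frame, evaluated at the real tangent vector `v`:
`D^{1,0} σ = ∂σ + N⁻¹ (∂N) σ` and `D^{0,1} σ = ∂̄σ`. -/
def chernD {m : ℕ} (N : EuclideanSpace ℂ (Fin m) → Matrix (Fin 2) (Fin 2) ℂ)
    (σ : EuclideanSpace ℂ (Fin m) → Fin 2 → ℂ) (z v : EuclideanSpace ℂ (Fin m)) : Fin 2 → ℂ :=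
  (dHol σ z v + ((N z)⁻¹ * Matrix.of fun i j => dHol (fun w => N w i j) z v).mulVec (σ z)) +
    dBar σ z v

/-- The second fundamental form `⟨D e₂, e₁⟩` of the inclusion `E ⊆ J^(2) E` (with respect to `ν`) at
`z`, a one-form on the (real) tangent space; `e₁`, `e₂` is the orthonormal frame obtained from
`s`, `∂_ν s`. -/
def secondFundamentalForm {m : ℕ} (ν : EuclideanSpace ℂ (Fin m) → EuclideanSpace ℂ (Fin m))
    (h : EuclideanSpace ℂ (Fin m) → ℂ) (z : EuclideanSpace ℂ (Fin m)) :
    EuclideanSpace ℂ (Fin m) → ℂ :=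
  fun v => fiberInner (jetMetric ν h z)
    (chernD (jetMetric ν h) (fun w => gramSchmidt₂ (jetMetric ν h w)) z v)
    (gramSchmidt₁ (jetMetric ν h z))

end

/-! Write `e z` for the evaluation functional at `z`. It depends holomorphically on `z`, in the norm
of the dual space (`analyticOnNhd_eval`), and `h z = ‖e z‖ ^ 2`. The submodule is the common kernel
of all `e p` and `∂_v e p` with `p ∈ Z` and `v` in any ambient direction (`mem_vanishing_two_iff`),
so the Riesz vectors of these functionals span a dense subspace of the quotient. Both equivalences
rest on one fact: the quotients are isomorphic iff the whole curvature form, in all ambient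
directions, agrees at the points of `Z`.

Necessity (`polarCurvature_eq_of_quotIso`). The Riesz vector of `e p` is a joint eigenvector of the
adjoint action, and those of `∂_v e p` are generalized eigenvectors. A unitary module map preserves
these relations. A functional satisfying them is determined by its value at `1`, so `e p` goes to `s
e' p` and `∂_v e p` to `s ∂_v e' p + t(v) e' p`. The curvature does not change under such a
substitution (`curvature_gauge`).

Sufficiency (`quotIso_of_polarCurvature_eq`). Off the diagonal the curvature becomes `∂_v ∂̄_u log
K(z, w)`, holomorphic in `z` and antiholomorphic in `w`, so equality on the diagonal of `Z` spreads
to nearby pairs of points of `Z` (`eq_zero_of_eq_zero_on_diagonal`). Multiply `e'` by a holomorphic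
factor that makes the two kernels agree against a base point. Two integrations along `Z` then
recover the kernel and its first derivatives in all directions (`gram_eq_of_polarCurvature_eq`).
Equal Gram matrices give a unitary; the jets near one point suffice, by the identity theorem on the
connected `Z`; and the Leibniz rule makes the unitary a module map.

Finally, sesquilinearity and hermitian symmetry recover the whole form from its tangential,
transverse and off-diagonal parts, and `𝕀(v) = -𝒦(v, ν) / √𝒦_trans` (`secondFundamentalForm_eq`).
Here `𝒦_trans > 0`, because the algebra contains the constants and the linear functions. -/

/-! ### Cauchy's formula on polydiscs, Osgood's lemma, Weierstrass' theorem -/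

section SeveralVariables

open MeasureTheory Metric

variable {F : Type*} [NormedAddCommGroup F] [NormedSpace ℂ F]

theorem torusMap_mem_closedBall {n : ℕ} (c : Fin n → ℂ) {r : ℝ} (hr : 0 ≤ r) (θ : Fin n → ℝ) :
    torusMap c (fun _ => r) θ ∈ closedBall c r := by
  rw [mem_closedBall, dist_pi_le_iff hr]
  intro i
  simp [torusMap, dist_eq_norm, abs_of_nonneg hr]

theorem norm_torusMap_sub_apply {n : ℕ} (c : Fin n → ℂ) {r : ℝ} (hr : 0 ≤ r) (θ : Fin n → ℝ)
    (i : Fin n) : ‖torusMap c (fun _ => r) θ i - c i‖ = r := by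
  simp [torusMap, abs_of_nonneg hr]

theorem torusMap_apply_sub_ne_zero {n : ℕ} {c w : Fin n → ℂ} {r : ℝ} (hr : 0 < r)
    (hw : w ∈ ball c r) (θ : Fin n → ℝ) (i : Fin n) :
    torusMap c (fun _ => r) θ i - w i ≠ 0 := by
  intro h
  have h1 := norm_torusMap_sub_apply c hr.le θ i
  rw [mem_ball, dist_pi_lt_iff hr] at hw
  have h2 := hw i
  rw [sub_eq_zero.mp h, ← dist_eq_norm] at h1
  exact h2.ne h1

theorem continuous_torusMap {n : ℕ} (c : Fin n → ℂ) (R : Fin n → ℝ) :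
    Continuous (torusMap c R) := by
  unfold torusMap; fun_prop

theorem differentiableAt_comp_line {E : Type*} [NormedAddCommGroup E] [NormedSpace ℂ E]
    {U : Set E} (hU : IsOpen U) {f : E → F}
    (hf : DifferentiableOn ℂ f U) {z : E} (hz : z ∈ U) (v : E) :
    DifferentiableAt ℂ (fun t : ℂ => f (z + t • v)) 0 := by
  have h1 : DifferentiableAt ℂ f (z + (0 : ℂ) • v) := by
    simpa using hf.differentiableAt (hU.mem_nhds hz)
  exact DifferentiableAt.comp (g := f) (f := fun t : ℂ => z + t • v) 0 h1 (by fun_prop)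

/-- Torus integrals of a continuous function against the Cauchy kernel are analytic. -/
theorem analyticAt_torusIntegral_prod_inv_smul {r : ℝ} (hr : 0 < r) {n : ℕ} {c : Fin n → ℂ}
    {f : (Fin n → ℂ) → F} (hf : ContinuousOn f (closedBall c r)) :
    AnalyticAt ℂ (fun w => ∯ ζ in T(c, fun _ => r), (∏ i, (ζ i - w i)⁻¹) • f ζ) c := by
  set K : Set (Fin n → ℝ) := Icc (0 : Fin n → ℝ) fun _ => 2 * Real.pi
  have hK : IsCompact K := isCompact_Icc
  have : CompactSpace K := isCompact_iff_compactSpace.mp hK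
  let μ : Measure K := Measure.comap Subtype.val volume
  have : IsFiniteMeasure μ := ⟨by
    rw [(MeasurableEmbedding.subtype_coe hK.measurableSet).comap_apply, image_univ,
      Subtype.range_coe]
    exact hK.measure_lt_top⟩
  let h : K → F := fun θ => (∏ i : Fin n, (r : ℂ) * Complex.exp (θ.1 i * Complex.I) * Complex.I) •
    f (torusMap c (fun _ => r) θ)
  have hh : Continuous h := by
    refine Continuous.smul ((by fun_prop : Continuous fun θ : Fin n → ℝ =>
      ∏ i : Fin n, (r : ℂ) * Complex.exp (θ i * Complex.I) * Complex.I).comp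
        continuous_subtype_val) ?_
    exact hf.comp_continuous ((continuous_torusMap _ _).comp continuous_subtype_val)
      fun θ => torusMap_mem_closedBall c hr.le θ
  have hint : ∀ g : C(K, ℂ), Integrable (fun θ => g θ • h θ) μ := fun g => by
    exact (g.continuous.smul hh).integrable_of_hasCompactSupport
      (HasCompactSupport.of_compactSpace _)
  -- Integration against `h` is bounded and linear on the Banach algebra `C(K, ℂ)`, so it suffices
  -- that the Cauchy kernel is analytic as a `C(K, ℂ)`-valued function of `w`; this follows from
  -- analyticity of inversion.
  let L : C(K, ℂ) →L[ℂ] F := LinearMap.mkContinuous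
    { toFun := fun g => ∫ θ, g θ • h θ ∂μ
      map_add' := fun a b => by
        simp only [ContinuousMap.add_apply, add_smul]
        exact integral_add (hint a) (hint b)
      map_smul' := fun a b => by
        simp only [ContinuousMap.smul_apply, smul_assoc]
        exact integral_smul a _ }
    (∫ θ, ‖h θ‖ ∂μ) (fun g => by
      refine (norm_integral_le_integral_norm _).trans ?_
      rw [mul_comm, ← integral_const_mul]
      refine integral_mono (hint g).norm ?_ fun θ => ?_
      · exact (hh.integrable_of_hasCompactSupport
          (HasCompactSupport.of_compactSpace _)).norm.const_mul _
      · simp only [norm_smul]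
        exact mul_le_mul_of_nonneg_right (g.norm_coe_le_norm θ) (norm_nonneg _))
  let ζ : Fin n → C(K, ℂ) := fun i => ⟨fun θ => torusMap c (fun _ => r) θ i,
    (continuous_apply i).comp ((continuous_torusMap c fun _ => r).comp continuous_subtype_val)⟩
  let A : (Fin n → ℂ) → C(K, ℂ) := fun w =>
    ∏ i, Ring.inverse (ζ i - algebraMap ℂ C(K, ℂ) (w i))
  have hu : ∀ w ∈ ball c r, ∀ i, IsUnit (ζ i - algebraMap ℂ C(K, ℂ) (w i)) := by
    intro w hw i
    rw [ContinuousMap.isUnit_iff_forall_ne_zero]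
    intro θ
    exact torusMap_apply_sub_ne_zero hr hw θ.1 i
  have hA : AnalyticAt ℂ A c := by
    refine Finset.analyticAt_fun_prod _ fun i _ => ?_
    obtain ⟨u, hu⟩ := hu c (mem_ball_self hr) i
    refine AnalyticAt.comp (g := Ring.inverse)
      (f := fun w : Fin n → ℂ => ζ i - algebraMap ℂ C(K, ℂ) (w i)) ?_ ?_
    · change AnalyticAt ℂ Ring.inverse (ζ i - algebraMap ℂ C(K, ℂ) (c i))
      rw [← hu]
      exact analyticAt_inverse u
    · refine analyticAt_const.sub ?_
      exact ((Algebra.linearMap ℂ C(K, ℂ)).toContinuousLinearMap ∘L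
        (ContinuousLinearMap.proj (R := ℂ) (φ := fun _ : Fin n => ℂ) i)).analyticAt c
  refine ((L.analyticAt (A c)).comp hA).congr ?_
  filter_upwards [isOpen_ball.mem_nhds (mem_ball_self hr)] with w hw
  have hev : ∀ θ : K, A w θ = ∏ i, (torusMap c (fun _ => r) θ i - w i)⁻¹ := by
    intro θ
    simp only [A, ContinuousMap.prod_apply]
    refine Finset.prod_congr rfl fun i _ => ?_
    have h1 := congrArg (fun g : C(K, ℂ) => g θ) (Ring.inverse_mul_cancel _ (hu w hw i))
    exact eq_inv_of_mul_eq_one_left h1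
  change ∫ θ : K, A w θ • h θ ∂μ = _
  rw [torusIntegral, ← integral_subtype_comap hK.measurableSet]
  refine integral_congr_ae (Eventually.of_forall fun θ => ?_)
  simp only [hev, h]
  rw [smul_comm]

variable [CompleteSpace F]

/-- The **Cauchy integral formula** for a polydisc. -/
theorem torusIntegral_prod_inv_smul {r : ℝ} (hr : 0 < r) : ∀ {n : ℕ} {c : Fin n → ℂ}
    {f : (Fin n → ℂ) → F}, ContinuousOn f (closedBall c r) →
    (∀ z ∈ closedBall c r, ∀ i,
      DifferentiableOn ℂ (fun t => f (Function.update z i t)) (ball (c i) r)) →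
    ∀ {w}, w ∈ ball c r →
      (∯ ζ in T(c, fun _ => r), (∏ i, (ζ i - w i)⁻¹) • f ζ) =
        (2 * Real.pi * Complex.I : ℂ) ^ n • f w := by
  intro n
  induction n with
  | zero =>
    intro c f hf hd w hw
    simp [Subsingleton.elim w c]
  | succ n ih =>
    intro c f hf hd w hw
    have hcons : ∀ {x : ℂ} {y : Fin n → ℂ}, x ∈ closedBall (c 0) r →
        y ∈ closedBall (c ∘ Fin.succ) r → (Fin.cons x y : Fin (n + 1) → ℂ) ∈ closedBall c r := by
      intro x y hx hy
      rw [mem_closedBall, dist_pi_le_iff hr.le] at hy ⊢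
      intro i
      refine Fin.cases ?_ (fun j => ?_) i
      · simpa using hx
      · simpa using hy j
    have hint : TorusIntegrable (fun ζ => (∏ i, (ζ i - w i)⁻¹) • f ζ) c (fun _ => r) := by
      refine ContinuousOn.integrableOn_compact isCompact_Icc (Continuous.continuousOn ?_)
      refine Continuous.smul ?_ ?_
      · refine continuous_finsetProd _ fun i _ => Continuous.inv₀ ?_ fun θ =>
          torusMap_apply_sub_ne_zero hr hw θ i
        exact ((continuous_apply i).comp (continuous_torusMap c fun _ => r)).sub
          (continuous_const (y := w i))
      · exact hf.comp_continuous (continuous_torusMap _ _)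
          fun θ => torusMap_mem_closedBall c hr.le θ
    have hw0 : w 0 ∈ ball (c 0) r := by
      rw [mem_ball, dist_pi_lt_iff hr] at hw; exact hw 0
    have hws : Fin.tail w ∈ ball (c ∘ Fin.succ) r := by
      rw [mem_ball, dist_pi_lt_iff hr] at hw ⊢; exact fun i => hw i.succ
    rw [torusIntegral_succ hint]
    -- The induction hypothesis evaluates the integral over the last `n` variables; the one-variable
    -- formula in the first variable does the rest.
    have hinner : EqOn (fun x => ∯ y in T(c ∘ Fin.succ, (fun _ => r) ∘ Fin.succ),
        (∏ i, ((Fin.cons x y : Fin (n + 1) → ℂ) i - w i)⁻¹) • f (Fin.cons x y))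
        (fun x => (x - w 0)⁻¹ • ((2 * Real.pi * Complex.I : ℂ) ^ n • f (Fin.cons x (Fin.tail w))))
        (sphere (c 0) r) := by
      intro x hx
      have hx' := sphere_subset_closedBall hx
      have := ih (c := c ∘ Fin.succ) (f := fun y => f (Fin.cons x y)) (w := Fin.tail w)
        (hf.comp (Continuous.continuousOn (by fun_prop)) fun y hy => hcons hx' hy)
        (fun z hz i => by
          simp only [Fin.cons_update]
          exact hd _ (hcons hx' hz) i.succ) hws
      simp only [Fin.prod_univ_succ, Fin.cons_zero, Fin.cons_succ, mul_smul]
      rw [torusIntegral_smul]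
      congr 1
    rw [circleIntegral.integral_congr hr.le hinner]
    have hd0 : DiffContOnCl ℂ (fun x => f (Fin.cons x (Fin.tail w))) (ball (c 0) r) := by
      constructor
      · have := hd (Fin.cons (c 0) (Fin.tail w))
          (hcons (mem_closedBall_self hr.le) (ball_subset_closedBall hws)) 0
        simpa only [Fin.update_cons_zero] using this
      · rw [closure_ball _ hr.ne']
        exact hf.comp (Continuous.continuousOn (by fun_prop))
          fun x hx => hcons hx (ball_subset_closedBall hws)
    simp only [smul_comm _ ((2 * Real.pi * Complex.I : ℂ) ^ n)]
    rw [circleIntegral.integral_smul, hd0.circleIntegral_sub_inv_smul hw0, smul_smul, ← pow_succ,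
      Fin.cons_self_tail]

/-- Near `c` the function is the Cauchy integral of its values on a torus, and such integrals are
analytic whenever the boundary values are continuous. -/
theorem analyticAt_of_continuousOn_of_separately_pi {n : ℕ} {U : Set (Fin n → ℂ)} (hU : IsOpen U)
    {f : (Fin n → ℂ) → F} (hf : ContinuousOn f U)
    (hd : ∀ z ∈ U, ∀ v, DifferentiableAt ℂ (fun t : ℂ => f (z + t • v)) 0) :
    AnalyticOnNhd ℂ f U := by
  intro c hc
  obtain ⟨r, hr, hrU⟩ := nhds_basis_closedBall.mem_iff.mp (hU.mem_nhds hc)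
  have hfr := hf.mono hrU
  have hsep : ∀ z ∈ closedBall c r, ∀ i,
      DifferentiableOn ℂ (fun t => f (Function.update z i t)) (ball (c i) r) := by
    intro z hz i t ht
    have hz' : Function.update z i t ∈ closedBall c r := by
      rw [mem_closedBall, dist_pi_le_iff hr.le] at hz ⊢
      intro j
      rcases eq_or_ne j i with rfl | hj
      · simpa using (mem_ball.mp ht).le
      · simpa [hj] using hz j
    have h1 := hd _ (hrU hz') (Pi.single i 1)
    have h2 : DifferentiableAt ℂ (fun s : ℂ => s - t) t := by fun_prop
    have h3 : DifferentiableAt ℂ (fun s : ℂ => f (Function.update z i t + (s - t) • Pi.single i 1))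
        t := by
      exact DifferentiableAt.comp (g := fun s : ℂ => f (Function.update z i t + s • Pi.single i 1))
        t (by simpa using h1) h2
    refine (h3.congr_of_eventuallyEq (Eventually.of_forall fun s => ?_)).differentiableWithinAt
    simp only
    congr 1
    ext j
    rcases eq_or_ne j i with rfl | hj
    · simp
    · simp [hj]
  have hpi : (2 * Real.pi * Complex.I : ℂ) ^ n ≠ 0 := pow_ne_zero _ (by
    simp [Real.pi_ne_zero])
  refine ((analyticAt_torusIntegral_prod_inv_smul hr hfr).const_smul
    (c := ((2 * Real.pi * Complex.I : ℂ) ^ n)⁻¹)).congr ?_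
  filter_upwards [isOpen_ball.mem_nhds (mem_ball_self hr)] with w hw
  simp only [Pi.smul_apply]
  rw [torusIntegral_prod_inv_smul hr hfr hsep hw, smul_smul, inv_mul_cancel₀ hpi, one_smul]

variable {E : Type*} [NormedAddCommGroup E] [NormedSpace ℂ E] [FiniteDimensional ℂ E]

/-- **Osgood's lemma**: a continuous function on an open subset of a finite dimensional space which
is holomorphic along complex lines is analytic. -/
theorem analyticOnNhd_of_continuousOn_of_line {U : Set E} (hU : IsOpen U)
    {f : E → F} (hf : ContinuousOn f U)
    (hd : ∀ z ∈ U, ∀ v, DifferentiableAt ℂ (fun t : ℂ => f (z + t • v)) 0) :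
    AnalyticOnNhd ℂ f U := by
  let φ : E ≃L[ℂ] (Fin (Module.finrank ℂ E) → ℂ) := (Module.finBasis ℂ E).equivFunL
  have h := analyticAt_of_continuousOn_of_separately_pi (U := φ.symm ⁻¹' U) (f := f ∘ φ.symm)
    (hU.preimage φ.symm.continuous) (hf.comp φ.symm.continuous.continuousOn fun _ h => h)
    (fun z hz v => by
      simpa using hd (φ.symm z) hz (φ.symm v))
  intro z hz
  have h1 : AnalyticAt ℂ ((f ∘ φ.symm) ∘ φ) z :=
    (h (φ z) (by simpa using hz)).comp (φ.toContinuousLinearMap.analyticAt z)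
  refine h1.congr (Eventually.of_forall fun w => ?_)
  simp

theorem DifferentiableOn.analyticOnNhd_of_finiteDimensional {U : Set E} (hU : IsOpen U) {f : E → F}
    (hf : DifferentiableOn ℂ f U) : AnalyticOnNhd ℂ f U :=
  analyticOnNhd_of_continuousOn_of_line hU hf.continuousOn
    fun _ hz v => differentiableAt_comp_line hU hf hz v

/-- Weierstrass' theorem: locally uniform limits of analytic functions are analytic. -/
theorem TendstoLocallyUniformlyOn.analyticOnNhd {ι : Type*} {l : Filter ι} [l.NeBot] {U : Set E}
    (hU : IsOpen U) {f : ι → E → F} {g : E → F} (h : TendstoLocallyUniformlyOn f g l U)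
    (hf : ∀ i, AnalyticOnNhd ℂ (f i) U) : AnalyticOnNhd ℂ g U := by
  -- The limit is continuous, and on each complex line the one-variable theorem applies.
  refine analyticOnNhd_of_continuousOn_of_line hU
    (h.continuousOn (Eventually.of_forall fun i => (hf i).continuousOn).frequently) ?_
  intro z hz v
  let ℓ : ℂ → E := fun t => z + t • v
  have hℓ : Continuous ℓ := by fun_prop
  have hV : IsOpen (ℓ ⁻¹' U) := hU.preimage hℓ
  have h0 : (0 : ℂ) ∈ ℓ ⁻¹' U := by simpa [ℓ] using hz
  have h1 : TendstoLocallyUniformlyOn (fun i => f i ∘ ℓ) (g ∘ ℓ) l (ℓ ⁻¹' U) :=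
    h.comp ℓ (fun _ h => h) hℓ.continuousOn
  refine (h1.differentiableOn (Eventually.of_forall fun i => ?_) hV).differentiableAt
    (hV.mem_nhds h0)
  exact (hf i).differentiableOn.comp (by fun_prop) fun _ h => h

end SeveralVariables

/-! ### From pointwise to norm holomorphy in a dual space -/

section StrongHolomorphy

open Metric

variable {E X : Type*} [NormedAddCommGroup E] [NormedSpace ℂ E]
  [NormedAddCommGroup X] [NormedSpace ℂ X]

/-- If `‖e‖ ≤ C` on a ball of radius `R` about `z`, then `e y x - e z x` has modulus at most `2 * C
* ‖x‖` there, and the Schwarz lemma gives a Lipschitz bound at `z` with constant `2 * C / R`,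
uniformly in the unit ball of `X`. -/
theorem continuousOn_of_locally_bounded_of_apply {U : Set E} (hU : IsOpen U)
    {e : E → StrongDual ℂ X} (he : ∀ x, DifferentiableOn ℂ (fun z => e z x) U)
    (hb : ∀ z ∈ U, ∃ V ∈ 𝓝 z, ∃ C : ℝ, ∀ w ∈ V ∩ U, ‖e w‖ ≤ C) : ContinuousOn e U := by
  intro z hz
  refine ContinuousAt.continuousWithinAt ?_
  obtain ⟨V, hV, C, hC⟩ := hb z hz
  obtain ⟨R, hR, hRV⟩ := nhds_basis_ball.mem_iff.mp (inter_mem hV (hU.mem_nhds hz))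
  have hC0 : 0 ≤ C := (norm_nonneg _).trans (hC z (hRV (mem_ball_self hR)))
  have key : ∀ w ∈ ball z R, dist (e w) (e z) ≤ 2 * C / R * dist w z := by
    intro w hw
    rw [dist_eq_norm]
    refine ContinuousLinearMap.opNorm_le_bound _ (by positivity) fun x => ?_
    have hmaps : MapsTo (fun z => e z x) (ball z R) (closedBall (e z x) (2 * C * ‖x‖)) := by
      intro y hy
      rw [mem_closedBall, dist_eq_norm]
      have h1 := (e y).le_of_opNorm_le (hC y (hRV hy)) x
      have h2 := (e z).le_of_opNorm_le (hC z (hRV (mem_ball_self hR))) x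
      exact (norm_sub_le _ _).trans (by linarith)
    have := Complex.dist_le_div_mul_dist_of_mapsTo_ball
      ((he x).mono (hRV.trans inter_subset_right)) hmaps hw
    rw [dist_eq_norm] at this
    refine this.trans (le_of_eq ?_)
    ring
  rw [ContinuousAt, tendsto_iff_dist_tendsto_zero]
  have hlim : Tendsto (fun w => 2 * C / R * dist w z) (𝓝 z) (𝓝 0) := by
    have : Continuous fun w => 2 * C / R * dist w z := by fun_prop
    simpa using this.tendsto z
  refine squeeze_zero' (Eventually.of_forall fun _ => dist_nonneg) ?_ hlim
  filter_upwards [ball_mem_nhds z hR] with w hw using key w hw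

/-- Continuity makes the vector-valued Cauchy integral of `e` meaningful; it is analytic, and
applying it to each `x` identifies it with `e`. -/
theorem differentiableAt_of_continuousOn_of_apply {U : Set ℂ} (hU : IsOpen U)
    {e : ℂ → StrongDual ℂ X} (hc : ContinuousOn e U)
    (he : ∀ x, DifferentiableOn ℂ (fun z => e z x) U) {z : ℂ} (hz : z ∈ U) :
    DifferentiableAt ℂ e z := by
  obtain ⟨r, hr, hrU⟩ := nhds_basis_closedBall.mem_iff.mp (hU.mem_nhds hz)
  lift r to NNReal using hr.le
  have hci : CircleIntegrable e z r :=
    (hc.mono (sphere_subset_closedBall.trans hrU)).circleIntegrable hr.le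
  have hps := hasFPowerSeriesOn_cauchy_integral hci (by exact_mod_cast hr)
  refine (hps.analyticAt.differentiableAt).congr_of_eventuallyEq ?_
  filter_upwards [ball_mem_nhds z hr] with w hw
  ext x
  have h1 : ((2 * Real.pi * Complex.I : ℂ)⁻¹ • ∮ ζ in C(z, r), (ζ - w)⁻¹ • e ζ x) = e w x :=
    ((he x).mono hrU).diffContOnCl_ball (subset_refl _)
      |>.two_pi_i_inv_smul_circleIntegral_sub_inv_smul hw
  rw [← h1]
  have hci2 : CircleIntegrable (fun ζ => (ζ - w)⁻¹ • e ζ) z r := by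
    refine ContinuousOn.circleIntegrable hr.le ?_
    refine ContinuousOn.smul (ContinuousOn.inv₀ (continuousOn_id.sub continuousOn_const) ?_)
      (hc.mono (sphere_subset_closedBall.trans hrU))
    intro ζ hζ h
    rw [show ζ = w from sub_eq_zero.mp h] at hζ
    exact (mem_ball.mp hw).ne (mem_sphere.mp hζ)
  have h2 : (∮ ζ in C(z, r), (ζ - w)⁻¹ • e ζ) x = ∮ ζ in C(z, r), (ζ - w)⁻¹ • e ζ x := by
    rw [circleIntegral, circleIntegral]
    have := (ContinuousLinearMap.apply ℂ ℂ x).intervalIntegral_comp_comm hci2.out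
    simpa using this.symm
  rw [_root_.smul_apply, h2]

/-- A locally bounded, pointwise holomorphic map into a dual space is norm analytic. -/
theorem analyticOnNhd_strongDual_of_apply [FiniteDimensional ℂ E] {U : Set E} (hU : IsOpen U)
    {e : E → StrongDual ℂ X} (he : ∀ x, DifferentiableOn ℂ (fun z => e z x) U)
    (hb : ∀ z ∈ U, ∃ V ∈ 𝓝 z, ∃ C : ℝ, ∀ w ∈ V ∩ U, ‖e w‖ ≤ C) : AnalyticOnNhd ℂ e U := by
  have hc := continuousOn_of_locally_bounded_of_apply hU he hb
  refine analyticOnNhd_of_continuousOn_of_line hU hc fun z hz v => ?_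
  have hℓ : Continuous fun t : ℂ => z + t • v := by fun_prop
  refine differentiableAt_of_continuousOn_of_apply (hU.preimage hℓ)
    (hc.comp hℓ.continuousOn fun _ h => h) (fun x => ?_) (by simpa using hz)
  exact (he x).comp (by fun_prop) fun _ h => h

end StrongHolomorphy

/-! ### Elements of `𝒜(Ω)` as holomorphic functions -/

section FunctionAlgebra

variable {m : ℕ} {Ω : Set (EuclideanSpace ℂ (Fin m))}

theorem evalA_of_mem {w : EuclideanSpace ℂ (Fin m)} (hw : w ∈ closure Ω) (f : AlgA Ω) :
    evalA Ω w f = f.1 ⟨w, hw⟩ := by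
  rw [evalA, dif_pos hw]; rfl

theorem evalA_mul {w : EuclideanSpace ℂ (Fin m)} (hw : w ∈ closure Ω) (f g : AlgA Ω) :
    evalA Ω w (f * g) = evalA Ω w f * evalA Ω w g := by
  simp only [evalA_of_mem hw]; rfl

theorem evalA_one {w : EuclideanSpace ℂ (Fin m)} (hw : w ∈ closure Ω) :
    evalA Ω w (1 : AlgA Ω) = 1 := by
  simp only [evalA_of_mem hw]; rfl

theorem analyticOnNhd_evalA (hΩ : IsOpen Ω) (hΩb : Bornology.IsBounded Ω) (f : AlgA Ω) :
    AnalyticOnNhd ℂ (fun w => evalA Ω w f) Ω := by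
  have : CompactSpace (closure Ω) := isCompact_iff_compactSpace.mp hΩb.isCompact_closure
  obtain ⟨u, hu, hlim⟩ := mem_closure_iff_seq_limit.mp f.2
  have hext : ∀ n, ∃ G : EuclideanSpace ℂ (Fin m) → ℂ, AnalyticOnNhd ℂ G Ω ∧
      ∀ w : closure Ω, u n w = G w := by
    intro n
    obtain ⟨U, G, -, hΩU, hG, huG⟩ := hu n
    exact ⟨G, hG.mono (subset_closure.trans hΩU), huG⟩
  choose G hG huG using hext
  refine TendstoLocallyUniformlyOn.analyticOnNhd hΩ (f := G) (l := atTop) ?_ hG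
  refine TendstoUniformlyOn.tendstoLocallyUniformlyOn ?_
  have hunif := ContinuousMap.tendsto_iff_tendstoUniformly.mp hlim
  rw [Metric.tendstoUniformlyOn_iff]
  rw [Metric.tendstoUniformly_iff] at hunif
  intro ε hε
  filter_upwards [hunif ε hε] with n hn w hw
  rw [evalA_of_mem (subset_closure hw), ← huG n ⟨w, subset_closure hw⟩]
  exact hn _

/-- A linear functional on the ambient space, as an element of `𝒜(Ω)`. -/
noncomputable def AlgA.ofDual (Ω : Set (EuclideanSpace ℂ (Fin m)))
    (ℓ : StrongDual ℂ (EuclideanSpace ℂ (Fin m))) : AlgA Ω :=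
  ⟨⟨fun w => ℓ w, ℓ.continuous.comp continuous_subtype_val⟩,
    subset_closure ⟨univ, ℓ, isOpen_univ, subset_univ _, ℓ.analyticOnNhd _, fun _ => rfl⟩⟩

theorem evalA_ofDual {w : EuclideanSpace ℂ (Fin m)} (hw : w ∈ closure Ω)
    (ℓ : StrongDual ℂ (EuclideanSpace ℂ (Fin m))) :
    evalA Ω w (AlgA.ofDual Ω ℓ) = ℓ w := by
  rw [evalA_of_mem hw]; rfl

end FunctionAlgebra

/-! ### The evaluation functionals of a quasi-free module -/

namespace QuasiFree

variable {m : ℕ} {Ω : Set (EuclideanSpace ℂ (Fin m))}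
  {H : Type*} [NormedAddCommGroup H] [InnerProductSpace ℂ H] [CompleteSpace H]

theorem eval_locally_bounded (M : QuasiFree Ω H) {w : EuclideanSpace ℂ (Fin m)} (hw : w ∈ Ω) :
    ∃ V ∈ 𝓝 w, ∃ C : ℝ, ∀ z ∈ V ∩ Ω, ‖M.eval z‖ ≤ C := by
  obtain ⟨V, hV, C, hC⟩ := M.eval_bounded w hw
  refine ⟨V, hV, max C 0, fun z hz => ?_⟩
  refine LinearMap.opNorm_extendOfNorm_le M.emb_dense (le_max_right _ _) fun f => ?_
  exact (hC z hz f).trans (mul_le_mul_of_nonneg_right (le_max_left _ _) (norm_nonneg _))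

theorem eval_act (M : QuasiFree Ω H) {w : EuclideanSpace ℂ (Fin m)} (hw : w ∈ Ω) (f : AlgA Ω)
    (x : H) : M.eval w (M.act f x) = evalA Ω w f * M.eval w x := by
  refine M.emb_dense.induction_on x (isClosed_eq (by fun_prop) (by fun_prop)) fun g => ?_
  rw [act_emb, eval_emb M hw, eval_emb M hw, evalA_mul (subset_closure hw)]

/-- Local boundedness of the evaluations turns norm convergence of algebra elements into locally
uniform convergence on `Ω`. -/
theorem analyticOnNhd_eval_apply (M : QuasiFree Ω H) (hΩ : IsOpen Ω)
    (hΩb : Bornology.IsBounded Ω) (x : H) : AnalyticOnNhd ℂ (fun w => M.eval w x) Ω := by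
  obtain ⟨u, hu, hlim⟩ := mem_closure_iff_seq_limit.mp (M.emb_dense x)
  choose f hf using hu
  have hfa : ∀ n, AnalyticOnNhd ℂ (fun w => M.eval w (u n)) Ω := fun n =>
    (analyticOnNhd_evalA hΩ hΩb (f n)).congr hΩ fun w hw => by
      simp only [← hf n]; rw [eval_emb M hw]
  refine TendstoLocallyUniformlyOn.analyticOnNhd hΩ (f := fun n w => M.eval w (u n))
    (l := atTop) ?_ hfa
  rw [Metric.tendstoLocallyUniformlyOn_iff]
  intro ε hε w hw
  obtain ⟨V, hV, C, hC⟩ := M.eval_locally_bounded hw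
  refine ⟨V ∩ Ω, mem_nhdsWithin.mpr ?_, ?_⟩
  · obtain ⟨V', hV'V, hV', hwV'⟩ := mem_nhds_iff.mp hV
    exact ⟨V', hV', hwV', inter_subset_inter_left _ hV'V⟩
  · have hC0 : 0 ≤ C := (norm_nonneg _).trans (hC w ⟨mem_of_mem_nhds hV, hw⟩)
    have h0 : Tendsto (fun n => C * ‖x - u n‖) atTop (𝓝 0) := by
      have h1 : Tendsto (fun n => C * ‖x - u n‖) atTop (𝓝 (C * ‖x - x‖)) :=
        ((tendsto_const_nhds.sub hlim).norm).const_mul C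
      simpa using h1
    filter_upwards [h0.eventually_lt_const hε] with n hn z hz
    rw [dist_eq_norm, ← map_sub]
    exact ((M.eval z).le_of_opNorm_le (hC z hz) _).trans_lt hn

theorem analyticOnNhd_eval (M : QuasiFree Ω H) (hΩ : IsOpen Ω) (hΩb : Bornology.IsBounded Ω) :
    AnalyticOnNhd ℂ M.eval Ω :=
  analyticOnNhd_strongDual_of_apply hΩ
    (fun x => (M.analyticOnNhd_eval_apply hΩ hΩb x).differentiableOn)
    fun _ hz => M.eval_locally_bounded hz

end QuasiFree

/-! ### Division by a defining equation -/

section Division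

open Metric

variable {E : Type*} [NormedAddCommGroup E] [NormedSpace ℂ E]

theorem ContinuousLinearMap.hasFDerivAt_apply_sub {F : Type*} [NormedAddCommGroup F]
    [NormedSpace ℂ F] (A : E →L[ℂ] F) (p y : E) : HasFDerivAt (fun y => A (y - p)) A y := by
  simp only [map_sub]
  exact A.hasFDerivAt.sub_const _

theorem exists_apply_eq_one {L : StrongDual ℂ E} (hL : L ≠ 0) : ∃ n, L n = 1 := by
  obtain ⟨v, hv⟩ := DFunLike.ne_iff.mp hL
  exact ⟨(L v)⁻¹ • v, by simpa using inv_mul_cancel₀ hv⟩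

variable [FiniteDimensional ℂ E]

/-- An analytic function vanishing on a hyperplane is divisible by its equation. -/
theorem AnalyticAt.exists_eq_linear_mul {f : E → ℂ} {p n : E} {L : StrongDual ℂ E}
    (hf : AnalyticAt ℂ f p) (hn : L n = 1) (h0 : ∀ᶠ y in 𝓝 p, L (y - p) = 0 → f y = 0) :
    ∃ g : E → ℂ, AnalyticAt ℂ g p ∧ ∀ᶠ y in 𝓝 p, f y = L (y - p) * g y := by
  let a : E → ℂ := fun y => fderiv ℂ f y n
  have ha : AnalyticAt ℂ a p :=
    ((ContinuousLinearMap.apply ℂ ℂ n).analyticAt _).comp hf.fderiv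
  -- `P` projects onto the hyperplane along `n`, and `γ y` runs from `P y` to `y`. As `f` vanishes
  -- at `P y`, the fundamental theorem of calculus gives the quotient as the mean of `∂_n f` over
  -- this segment.
  let P : E → E := fun y => y - L (y - p) • n
  let γ : E → ℝ → E := fun y s => P y + ((s : ℂ) * L (y - p)) • n
  have hPc : Continuous P := by fun_prop
  have hP : P p = p := by simp [P]
  have hfd : ∀ᶠ y in 𝓝 p, ‖fderiv ℂ a y‖ < ‖fderiv ℂ a p‖ + 1 :=
    ha.fderiv.continuousAt.norm.eventually_lt_const (lt_add_one _)
  obtain ⟨r, hr, hrs⟩ := nhds_basis_ball.eventually_iff.mp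
    (hf.eventually_analyticAt.and (ha.eventually_analyticAt.and (hfd.and h0)))
  obtain ⟨δ, hδ, hδs⟩ := nhds_basis_ball.mem_iff.mp
    (inter_mem (ball_mem_nhds p hr) (hPc.continuousAt.preimage_mem_nhds
      (by rw [hP]; exact ball_mem_nhds p hr)))
  have hγ : ∀ y ∈ ball p δ, ∀ s ∈ Icc (0 : ℝ) 1, γ y s ∈ ball p r := by
    intro y hy s hs
    have h1 := (convex_ball p r) (hδs hy).2 (hδs hy).1 (sub_nonneg.mpr hs.2) hs.1 (by ring)
    convert h1 using 1
    simp only [γ, P]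
    rw [← Complex.coe_smul, ← Complex.coe_smul]
    push_cast
    module
  have hγs : ∀ y, Continuous (γ y) := fun y => by
    simp only [γ]; fun_prop
  let A : E →L[ℂ] E := L.smulRight n
  have hγy : ∀ s : ℝ, ∀ y, HasFDerivAt (fun y => γ y s)
      (ContinuousLinearMap.id ℂ E - A + (s : ℂ) • A) y := by
    intro s y
    have h1 : HasFDerivAt (fun y => A (y - p)) A y :=
      A.hasFDerivAt_apply_sub p y
    have h2 := ((hasFDerivAt_id (𝕜 := ℂ) y).sub h1).add (h1.const_smul (s : ℂ))
    refine h2.congr_of_eventuallyEq (Eventually.of_forall fun z => ?_)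
    simp [γ, P, A, mul_smul]
  have hac : ContinuousOn a (ball p r) := fun y hy => (hrs hy).2.1.continuousAt.continuousWithinAt
  have hacont : ∀ y ∈ ball p δ, ContinuousOn (fun s : ℝ => a (γ y s)) (Icc 0 1) := fun y hy =>
    hac.comp (hγs y).continuousOn fun s hs => hγ y hy s hs
  let g : E → ℂ := fun y => ∫ s in (0 : ℝ)..1, a (γ y s)
  have huI : Set.uIoc (0 : ℝ) 1 ⊆ Icc 0 1 := by
    rw [Set.uIoc_of_le zero_le_one]; exact Ioc_subset_Icc_self
  refine ⟨g, ?_, ?_⟩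
  · refine DifferentiableOn.analyticOnNhd_of_finiteDimensional isOpen_ball ?_ p
      (mem_ball_self hδ)
    intro y hy
    refine DifferentiableAt.differentiableWithinAt ?_
    refine (intervalIntegral.hasFDerivAt_integral_of_dominated_of_fderiv_le
      (F' := fun y s => (fderiv ℂ a (γ y s)).comp (ContinuousLinearMap.id ℂ E - A + (s : ℂ) • A))
      (bound := fun _ => (‖fderiv ℂ a p‖ + 1) * (‖ContinuousLinearMap.id ℂ E - A‖ + ‖A‖))
      (isOpen_ball.mem_nhds hy) ?_ ?_ ?_ ?_ ?_ ?_).differentiableAt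
    · filter_upwards [isOpen_ball.mem_nhds hy] with z hz
      exact ((hacont z hz).mono huI).aestronglyMeasurable measurableSet_uIoc
    · exact (ContinuousOn.intervalIntegrable (by
        rw [Set.uIcc_of_le zero_le_one]; exact hacont y hy))
    · refine ContinuousOn.aestronglyMeasurable ?_ measurableSet_uIoc
      refine ContinuousOn.clm_comp ?_ (by fun_prop)
      have hfa : ContinuousOn (fderiv ℂ a) (ball p r) := fun z hz =>
        (hrs hz).2.1.fderiv.continuousAt.continuousWithinAt
      exact hfa.comp (hγs y).continuousOn fun s hs => hγ y hy s (huI hs)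
    · refine Eventually.of_forall fun s hs z hz => ?_
      refine (ContinuousLinearMap.opNorm_comp_le _ _).trans ?_
      have h1 := (hrs (hγ z hz s (huI hs))).2.2.1.le
      refine mul_le_mul h1 ?_ (norm_nonneg _) (by positivity)
      refine (norm_add_le _ _).trans (by
        gcongr
        rw [norm_smul]
        have : ‖(s : ℂ)‖ ≤ 1 := by
          rw [Complex.norm_real, Real.norm_eq_abs, abs_le]
          exact ⟨by linarith [(huI hs).1], (huI hs).2⟩
        exact mul_le_of_le_one_left (norm_nonneg _) this)
    · exact intervalIntegrable_const
    · refine Eventually.of_forall fun s hs z hz => ?_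
      exact ((hrs (hγ z hz s (huI hs))).2.1.differentiableAt.hasFDerivAt).comp z (hγy s z)
  · filter_upwards [ball_mem_nhds p hδ] with y hy
    have hder : ∀ s ∈ Set.uIcc (0 : ℝ) 1,
        HasDerivAt (fun s => f (γ y s)) (L (y - p) * a (γ y s)) s := by
      intro s hs
      rw [Set.uIcc_of_le zero_le_one] at hs
      have h1 : HasDerivAt (γ y) (L (y - p) • n) s := by
        have h2 : HasDerivAt (fun s : ℝ => (s : ℂ) * L (y - p)) (1 * L (y - p)) s :=
          (Complex.ofRealCLM.hasDerivAt (x := s)).mul_const _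
        have h3 := (h2.smul_const n).const_add (P y)
        rwa [one_mul] at h3
      have h4 := ((hrs (hγ y hy s hs)).1.differentiableAt.hasFDerivAt.restrictScalars ℝ)
        |>.comp_hasDerivAt s h1
      have h5 : fderiv ℂ f (γ y s) (L (y - p) • n) = L (y - p) * a (γ y s) := by
        rw [map_smul, smul_eq_mul]
      rw [← h5]
      exact h4
    have hint := intervalIntegral.integral_eq_sub_of_hasDerivAt hder
      (ContinuousOn.intervalIntegrable (by
        rw [Set.uIcc_of_le zero_le_one]; exact (hacont y hy).const_smul (L (y - p))))
    rw [intervalIntegral.integral_const_mul] at hint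
    have hP0 : f (γ y 0) = 0 := by
      refine (hrs (hγ y hy 0 (by simp))).2.2.2 ?_
      simp [γ, P, hn]
    have hP1 : γ y 1 = y := by simp [γ, P]
    rw [hP0, hP1, sub_zero] at hint
    exact hint.symm

/-- A submersive analytic function is linear in suitable analytic coordinates. -/
theorem AnalyticAt.exists_straightening {φ : E → ℂ} {p : E} (hφ : AnalyticAt ℂ φ p) (h0 : φ p = 0)
    (hd : fderiv ℂ φ p ≠ 0) :
    ∃ Ψ G : E → E, AnalyticAt ℂ Ψ p ∧ AnalyticAt ℂ G p ∧ Ψ p = p ∧ G p = p ∧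
      (∀ᶠ z in 𝓝 p, G (Ψ z) = z) ∧ (∀ᶠ y in 𝓝 p, Ψ (G y) = y) ∧
      (∀ z, fderiv ℂ φ p (Ψ z - p) = φ z) ∧ fderiv ℂ G p = ContinuousLinearMap.id ℂ E := by
  set L := fderiv ℂ φ p
  obtain ⟨n, hn⟩ := exists_apply_eq_one hd
  -- Only the `n`-coordinate is corrected, by a term with zero differential at `p`: thus `L (Ψ z -
  -- p) = φ z`, and `Ψ` is invertible near `p` with differential the identity there.
  let Ψ : E → E := fun z => z + (φ z - L (z - p)) • n
  have hΨa : AnalyticAt ℂ Ψ p := by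
    refine analyticAt_id.add (AnalyticAt.smul (hφ.sub ?_) analyticAt_const)
    exact (L.analyticAt _).comp (analyticAt_id.sub analyticAt_const)
  have hΨp : Ψ p = p := by simp [Ψ, h0]
  have hΨd : fderiv ℂ Ψ p = ContinuousLinearMap.id ℂ E := by
    have h1 : HasFDerivAt (fun z => L (z - p)) L p :=
      L.hasFDerivAt_apply_sub p p
    have h2 := (hasFDerivAt_id (𝕜 := ℂ) p).add
      (((hφ.differentiableAt.hasFDerivAt).sub h1).smul_const n)
    refine h2.fderiv.trans ?_
    simp [L]
  have hs : HasStrictFDerivAt Ψ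
      ((ContinuousLinearEquiv.refl ℂ E : E ≃L[ℂ] E) : E →L[ℂ] E) p := by
    have := hΨa.hasStrictFDerivAt
    rwa [hΨd] at this
  let R := hs.toOpenPartialHomeomorph Ψ
  have hpR : p ∈ R.source := hs.mem_toOpenPartialHomeomorph_source
  have hRΨ : ∀ z, R z = Ψ z := fun z => rfl
  have hRp : R p = p := hΨp
  have hpT : p ∈ R.target := by
    have := R.map_source hpR
    rwa [hRp] at this
  have hGp : R.symm p = p := by
    have := R.left_inv hpR
    rwa [hRp] at this
  have hGa : AnalyticAt ℂ R.symm p := by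
    have := R.analyticAt_symm' (i := ContinuousLinearEquiv.refl ℂ E) hpR hΨa hΨd
    rwa [hRp] at this
  have hli := R.eventually_left_inverse hpR
  have hri := R.eventually_right_inverse hpT
  refine ⟨Ψ, R.symm, hΨa, hGa, hΨp, hGp, hli, hri, fun z => ?_, ?_⟩
  · simp only [Ψ, map_sub, map_add, map_smul, hn, smul_eq_mul]
    ring
  · have h1 : HasFDerivAt (Ψ ∘ R.symm) ((fderiv ℂ Ψ p).comp (fderiv ℂ R.symm p)) p := by
      refine HasFDerivAt.comp p ?_ hGa.differentiableAt.hasFDerivAt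
      rw [hGp]; exact hΨa.differentiableAt.hasFDerivAt
    have h2 : HasFDerivAt (Ψ ∘ R.symm) (ContinuousLinearMap.id ℂ E) p :=
      (hasFDerivAt_id p).congr_of_eventuallyEq hri
    have h3 := h1.unique h2
    rwa [hΨd, ContinuousLinearMap.id_comp] at h3

/-- An analytic function vanishing on a smooth hypersurface is divisible by its equation. -/
theorem AnalyticAt.exists_eq_mul {φ f : E → ℂ} {p : E} (hφ : AnalyticAt ℂ φ p) (h0 : φ p = 0)
    (hd : fderiv ℂ φ p ≠ 0) (hf : AnalyticAt ℂ f p) (hfφ : ∀ᶠ z in 𝓝 p, φ z = 0 → f z = 0) :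
    ∃ g : E → ℂ, AnalyticAt ℂ g p ∧ ∀ᶠ z in 𝓝 p, f z = φ z * g z := by
  obtain ⟨Ψ, G, hΨ, hG, hΨp, hGp, hGΨ, hΨG, hL, -⟩ := hφ.exists_straightening h0 hd
  obtain ⟨n, hn⟩ := exists_apply_eq_one hd
  have hGt : Tendsto G (𝓝 p) (𝓝 p) := by
    simpa [ContinuousAt, hGp] using hG.continuousAt
  have hΨt : Tendsto Ψ (𝓝 p) (𝓝 p) := by
    simpa [ContinuousAt, hΨp] using hΨ.continuousAt
  obtain ⟨g, hg, hfg⟩ := AnalyticAt.exists_eq_linear_mul (f := f ∘ G) (p := p)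
    (hf.comp_of_eq hG hGp) hn (by
      filter_upwards [hGt.eventually hfφ, hΨG] with y h1 h2 h3
      refine h1 ?_
      rw [← hL, h2, h3])
  refine ⟨g ∘ Ψ, hg.comp_of_eq hΨ hΨp, ?_⟩
  filter_upwards [hΨt.eventually hfg, hGΨ] with z h1 h2
  simp only [Function.comp_apply, h2, hL] at h1
  exact h1

/-- An analytic function vanishing to second order on a smooth hypersurface is divisible by the
square of its equation. -/
theorem AnalyticAt.exists_eq_sq_mul {φ f : E → ℂ} {p : E} (hφ : AnalyticAt ℂ φ p) (h0 : φ p = 0)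
    (hd : fderiv ℂ φ p ≠ 0) (hf : AnalyticAt ℂ f p)
    (hfφ : ∀ᶠ z in 𝓝 p, φ z = 0 → f z = 0 ∧ fderiv ℂ f z = 0) :
    ∃ g : E → ℂ, AnalyticAt ℂ g p ∧ ∀ᶠ z in 𝓝 p, f z = φ z ^ 2 * g z := by
  obtain ⟨g, hg, hfg⟩ := hφ.exists_eq_mul h0 hd hf (hfφ.mono fun z h hz => (h hz).1)
  have hd' : ∀ᶠ z in 𝓝 p, fderiv ℂ φ z ≠ 0 := hφ.fderiv.continuousAt.eventually_ne hd
  -- At a zero of `φ` the product rule for `f = φ g` reads `0 = g dφ`, and `dφ ≠ 0`; so `g` vanishes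
  -- there and can be divided once more.
  obtain ⟨g₂, hg₂, hgg₂⟩ := hφ.exists_eq_mul h0 hd hg (by
    filter_upwards [hfφ, hfg.eventually_nhds, hd', hg.eventually_analyticAt,
      hφ.eventually_analyticAt] with z h1 h2 h3 h4 h5 hz
    have h6 : fderiv ℂ f z = φ z • fderiv ℂ g z + g z • fderiv ℂ φ z := by
      rw [Filter.EventuallyEq.fderiv_eq h2]
      exact fderiv_fun_mul h5.differentiableAt h4.differentiableAt
    rw [(h1 hz).2] at h6
    have h7 : g z • fderiv ℂ φ z = 0 := by
      ext v
      simpa [hz] using (DFunLike.congr_fun h6 v).symm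
    exact (smul_eq_zero.mp h7).resolve_right h3)
  refine ⟨g₂, hg₂, ?_⟩
  filter_upwards [hfg, hgg₂] with z h1 h2
  rw [h1, h2]; ring

end Division

/-! ### Local geometry of hypersurfaces and the identity theorem -/

section Hypersurface

variable {m : ℕ} {Ω Z U : Set (EuclideanSpace ℂ (Fin m))} {φ : EuclideanSpace ℂ (Fin m) → ℂ}
  {p : EuclideanSpace ℂ (Fin m)}

/-- A smooth hypersurface has a local analytic parametrization by its tangent space. -/
theorem IsDefiningFunction.exists_parametrization (h : IsDefiningFunction Ω Z U φ) (hpU : p ∈ U)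
    (hpZ : p ∈ Z) :
    ∃ F : (fderiv ℂ φ p).ker → EuclideanSpace ℂ (Fin m), AnalyticAt ℂ F 0 ∧ F 0 = p ∧
      (∀ᶠ x in 𝓝 0, F x ∈ Z) ∧ fderiv ℂ F 0 = (fderiv ℂ φ p).ker.subtypeL ∧
      ∀ W ∈ 𝓝 (0 : (fderiv ℂ φ p).ker), ∀ᶠ z in 𝓝[Z] p, z ∈ F '' W := by
  have hφp : φ p = 0 := (h.zero_iff p hpU).mpr hpZ
  obtain ⟨Ψ, G, hΨ, hG, hΨp, hGp, hGΨ, hΨG, hL, hGd⟩ :=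
    (h.holo p hpU).exists_straightening hφp (h.fderiv_ne_zero p ⟨hpU, hpZ⟩)
  set L := fderiv ℂ φ p
  let ι : L.ker → EuclideanSpace ℂ (Fin m) := fun x => p + x
  have hι : AnalyticAt ℂ ι 0 := analyticAt_const.add (L.ker.subtypeL.analyticAt 0)
  have hι0 : ι 0 = p := by simp [ι]
  have hιt : Tendsto ι (𝓝 0) (𝓝 p) := by
    simpa [ContinuousAt, hι0] using hι.continuousAt
  have hGt : Tendsto G (𝓝 p) (𝓝 p) := by
    simpa [ContinuousAt, hGp] using hG.continuousAt
  have hΨt : Tendsto Ψ (𝓝 p) (𝓝 p) := by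
    simpa [ContinuousAt, hΨp] using hΨ.continuousAt
  have hUp : ∀ᶠ z in 𝓝 p, z ∈ U := h.isOpen.mem_nhds hpU
  -- The inverse `G` of the straightening map carries the affine tangent plane at `p` onto `Z`,
  -- locally.
  refine ⟨G ∘ ι, hG.comp_of_eq hι hι0, by simp [hι0, hGp], ?_, ?_, ?_⟩
  · filter_upwards [hιt.eventually hΨG, hιt.eventually (hGt.eventually hUp)] with x h1 h2
    rw [Function.comp_apply, ← h.zero_iff _ h2, ← hL, h1]
    simp [ι]
  · have h1 : HasFDerivAt ι L.ker.subtypeL 0 := by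
      have := (L.ker.subtypeL.hasFDerivAt (x := 0)).const_add p
      exact this
    have h2 : HasFDerivAt G (ContinuousLinearMap.id ℂ _) (ι 0) := by
      rw [hι0, ← hGd]; exact hG.differentiableAt.hasFDerivAt
    have h3 := (h2.comp 0 h1).fderiv
    rwa [ContinuousLinearMap.id_comp] at h3
  · intro W hW
    obtain ⟨W', hW', hWW'⟩ := (mem_nhds_induced (Subtype.val : L.ker → _) 0 W).mp hW
    have hcont : Tendsto (fun z => Ψ z - p) (𝓝 p) (𝓝 (0 : EuclideanSpace ℂ (Fin m))) := by
      simpa using hΨt.sub_const p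
    have hW'0 : W' ∈ 𝓝 (0 : EuclideanSpace ℂ (Fin m)) := by simpa using hW'
    rw [eventually_nhdsWithin_iff]
    filter_upwards [hcont.eventually hW'0, hGΨ, hUp] with z h1 h2 h3 hz
    have hker : Ψ z - p ∈ L.ker := by
      rw [LinearMap.mem_ker]
      exact (hL z).trans ((h.zero_iff z h3).mpr hz)
    refine ⟨⟨Ψ z - p, hker⟩, hWW' h1, ?_⟩
    simp [ι, h2]

/-- A parametrization `F` with image in `Z` is annihilated by every defining function `ψ`, so `dψ_p`
vanishes on the image `ker dφ_p` of `dF_0`. Hence one defining function decides membership. -/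
theorem IsDefiningFunction.mem_tangentZ_iff (h : IsDefiningFunction Ω Z U φ) (hpU : p ∈ U)
    (hpZ : p ∈ Z) {v : EuclideanSpace ℂ (Fin m)} :
    v ∈ tangentZ Ω Z p ↔ fderiv ℂ φ p v = 0 := by
  refine ⟨fun hv => hv U φ h hpU, fun hv V ψ hψ hpV => ?_⟩
  obtain ⟨F, hF, hF0, hFZ, hFd, -⟩ := h.exists_parametrization hpU hpZ
  have hFt : Tendsto F (𝓝 0) (𝓝 p) := by
    simpa [ContinuousAt, hF0] using hF.continuousAt
  have h1 : (ψ ∘ F) =ᶠ[𝓝 0] fun _ => 0 := by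
    filter_upwards [hFZ, hFt.eventually (hψ.isOpen.mem_nhds hpV)] with x h2 h3
    exact (hψ.zero_iff _ h3).mpr h2
  have h2 : HasFDerivAt (ψ ∘ F) ((fderiv ℂ ψ p).comp (fderiv ℂ F 0)) 0 := by
    refine HasFDerivAt.comp 0 ?_ hF.differentiableAt.hasFDerivAt
    rw [hF0]; exact (hψ.holo p hpV).differentiableAt.hasFDerivAt
  have h3 := h2.unique ((hasFDerivAt_const (0 : ℂ) _).congr_of_eventuallyEq h1)
  have h4 := DFunLike.congr_fun h3 ⟨v, hv⟩
  rw [hFd] at h4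
  simpa using h4

/-- The identity theorem on a connected hypersurface. -/
theorem IsHypersurface.eqOn_zero {W : Type*} [NormedAddCommGroup W] [NormedSpace ℂ W]
    (hZ : IsHypersurface Ω Z) (hZc : IsPreconnected Z)
    {f : EuclideanSpace ℂ (Fin m) → W} (hf : AnalyticOnNhd ℂ f Ω) (hp : p ∈ Z)
    (h0 : ∀ᶠ z in 𝓝[Z] p, f z = 0) : ∀ z ∈ Z, f z = 0 := by
  -- Vanishing on a neighbourhood in `Z` is a locally constant property of the point: in a chart it
  -- spreads over a whole ball by the usual identity theorem.
  have hloc : ∀ x ∈ Z, ∀ᶠ y in 𝓝[Z] x, (∀ᶠ z in 𝓝[Z] x, f z = 0) ↔ ∀ᶠ z in 𝓝[Z] y, f z = 0 := by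
    intro x hx
    obtain ⟨V, φ, hφ, hxV⟩ := hZ.2 x hx
    obtain ⟨F, hF, hF0, hFZ, hFd, hFW⟩ := hφ.exists_parametrization hxV hx
    obtain ⟨ε, hε, hball⟩ := Metric.nhds_basis_ball.eventually_iff.mp
      (hF.eventually_analyticAt.and hFZ)
    have hFan : AnalyticOnNhd ℂ (f ∘ F) (Metric.ball 0 ε) := fun b hb =>
      (hf (F b) (hZ.1 (hball hb).2)).comp (hball hb).1
    filter_upwards [(hFW _ (Metric.ball_mem_nhds 0 hε)),
      eventually_eventually_nhdsWithin.mpr (hFW _ (Metric.ball_mem_nhds 0 hε))] with y hy hyloc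
    obtain ⟨b, hb, rfl⟩ := hy
    have key : ∀ c ∈ Metric.ball (0 : (fderiv ℂ φ x).ker) ε, (∀ᶠ z in 𝓝[Z] (F c), f z = 0) →
        EqOn (f ∘ F) 0 (Metric.ball 0 ε) := by
      intro c hc hev
      refine hFan.eqOn_zero_of_preconnected_of_eventuallyEq_zero
        (convex_ball _ _).isPreconnected hc ?_
      have ht : Tendsto F (𝓝 c) (𝓝[Z] (F c)) :=
        tendsto_nhdsWithin_iff.mpr ⟨(hball hc).1.continuousAt,
          Filter.mem_of_superset (Metric.isOpen_ball.mem_nhds hc) fun z hz => (hball hz).2⟩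
      exact ht.eventually hev
    constructor
    · intro hev
      rw [← hF0] at hev
      filter_upwards [hyloc] with z hz
      obtain ⟨d, hd, rfl⟩ := hz
      exact key 0 (Metric.mem_ball_self hε) hev hd
    · intro hev
      filter_upwards [hFW _ (Metric.ball_mem_nhds 0 hε)] with z hz
      obtain ⟨d, hd, rfl⟩ := hz
      exact key b hb hev hd
  intro z hz
  have := hZc.induction₂ (fun x y => (∀ᶠ z in 𝓝[Z] x, f z = 0) ↔ ∀ᶠ z in 𝓝[Z] y, f z = 0)
    hloc (fun _ _ _ _ _ _ => Iff.trans) (fun _ _ _ _ => Iff.symm) hp hz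
  exact (this.mp h0).self_of_nhdsWithin hz

theorem IsDefiningFunction.frequently_ne_zero (h : IsDefiningFunction Ω Z U φ) (hpU : p ∈ U)
    (hpZ : p ∈ Z) : ∃ᶠ z in 𝓝 p, φ z ≠ 0 := by
  intro hev
  have h1 : φ =ᶠ[𝓝 p] fun _ => 0 := hev.mono fun z hz => not_not.mp hz
  exact h.fderiv_ne_zero p ⟨hpU, hpZ⟩ (by simpa using h1.fderiv_eq)

/-- Local quotients exist by division at the zeros of `φ` and trivially elsewhere. They glue because
two of them agree where `φ ≠ 0`, and every zero of `φ` in `U` is a limit of such points. -/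
theorem IsDefiningFunction.exists_eq_sq_mul (h : IsDefiningFunction Ω Z U φ)
    {f : EuclideanSpace ℂ (Fin m) → ℂ} (hf : AnalyticOnNhd ℂ f Ω)
    (hfZ : ∀ z ∈ Z, f z = 0 ∧ fderiv ℂ f z = 0) :
    ∃ g : EuclideanSpace ℂ (Fin m) → ℂ, AnalyticOnNhd ℂ g U ∧ ∀ z ∈ U, f z = φ z ^ 2 * g z := by
  have hloc : ∀ q ∈ U, ∃ g : EuclideanSpace ℂ (Fin m) → ℂ, AnalyticAt ℂ g q ∧
      ∀ᶠ z in 𝓝 q, f z = φ z ^ 2 * g z := by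
    intro q hq
    by_cases h0 : φ q = 0
    · refine (h.holo q hq).exists_eq_sq_mul h0 (h.fderiv_ne_zero q ⟨hq, (h.zero_iff q hq).mp h0⟩)
        (hf q (h.subset hq)) ?_
      filter_upwards [h.isOpen.mem_nhds hq] with z hz hφz
      exact hfZ z ((h.zero_iff z hz).mp hφz)
    · refine ⟨fun z => f z / φ z ^ 2, (hf q (h.subset hq)).div ((h.holo q hq).pow 2)
        (pow_ne_zero 2 h0), ?_⟩
      filter_upwards [(h.holo q hq).continuousAt.eventually_ne h0] with z hz
      field_simp
  choose! g hg hfg using hloc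
  refine ⟨fun z => g z z, fun q hq => ?_, fun z hz => (hfg z hz).self_of_nhds⟩
  refine (hg q hq).congr ?_
  filter_upwards [(hfg q hq).eventually_nhds, (hg q hq).eventually_analyticAt,
    h.isOpen.mem_nhds hq] with z h1 h2 hz
  by_cases h0 : φ z = 0
  · have hfr := h.frequently_ne_zero hz ((h.zero_iff z hz).mp h0)
    have heq : ∃ᶠ y in 𝓝 z, g q y - g z y = 0 := by
      refine (hfr.and_eventually (h1.and (hfg z hz))).mono ?_
      rintro y ⟨hy, hy1, hy2⟩
      rw [hy1] at hy2
      rw [mul_left_cancel₀ (pow_ne_zero 2 hy) hy2, sub_self]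
    by_contra hne
    have hcont : ContinuousAt (fun y => g q y - g z y) z :=
      h2.continuousAt.sub (hg z hz).continuousAt
    exact heq (hcont.eventually_ne (sub_ne_zero.mpr hne))
  · have h3 := h1.self_of_nhds
    rw [(hfg z hz).self_of_nhds] at h3
    exact (mul_left_cancel₀ (pow_ne_zero 2 h0) h3).symm

end Hypersurface

/-! ### The submodule in terms of first order jets -/

namespace QuasiFree

variable {m : ℕ} {Ω Z : Set (EuclideanSpace ℂ (Fin m))}
  {H : Type*} [NormedAddCommGroup H] [InnerProductSpace ℂ H] [CompleteSpace H]

/-- The functions vanishing to order two on `Z` are those vanishing on `Z` with their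
differential. -/
theorem mem_vanishing_two_iff (M : QuasiFree Ω H) (hΩ : IsOpen Ω) (hΩb : Bornology.IsBounded Ω)
    (hZ : IsHypersurface Ω Z) {x : H} :
    x ∈ M.vanishing Z 2 ↔
      ∀ p ∈ Z, M.eval p x = 0 ∧ ∀ v, fderiv ℂ M.eval p v x = 0 := by
  have hd : ∀ p ∈ Ω, fderiv ℂ (fun w => M.eval w x) p =
      (ContinuousLinearMap.apply ℂ ℂ x).comp (fderiv ℂ M.eval p) := fun p hp =>
    ((ContinuousLinearMap.apply ℂ ℂ x).hasFDerivAt.comp p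
      (M.analyticOnNhd_eval hΩ hΩb p hp).differentiableAt.hasFDerivAt).fderiv
  constructor
  · intro hx p hp
    obtain ⟨U, φ, hφ, hpU⟩ := hZ.2 p hp
    obtain ⟨g, hg, hfg⟩ := hx U φ hφ
    have h0 : φ p = 0 := (hφ.zero_iff p hpU).mpr hp
    refine ⟨by rw [hfg p hpU, h0]; ring, fun v => ?_⟩
    have h1 : (fun w => M.eval w x) =ᶠ[𝓝 p] fun w => φ w ^ 2 * g w := by
      filter_upwards [hφ.isOpen.mem_nhds hpU] with z hz using hfg z hz
    have h2 : HasFDerivAt (fun w => φ w ^ 2 * g w) _ p :=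
      (((hφ.holo p hpU).differentiableAt.hasFDerivAt).pow 2).mul
        (hg p hpU).differentiableAt.hasFDerivAt
    have h3 := DFunLike.congr_fun (h1.fderiv_eq.trans h2.fderiv) v
    rw [hd p (hZ.1 hp)] at h3
    simpa [h0] using h3
  · intro hx U φ hφ
    refine hφ.exists_eq_sq_mul (M.analyticOnNhd_eval_apply hΩ hΩb x) fun z hz => ?_
    refine ⟨(hx z hz).1, ?_⟩
    rw [hd z (hZ.1 hz)]
    ext v
    exact (hx z hz).2 v

end QuasiFree

noncomputable section

/-! ### Inner products of functionals and their Wirtinger derivatives -/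

section DualInner

variable {X : Type*} [NormedAddCommGroup X] [InnerProductSpace ℂ X] [CompleteSpace X]

/-- The inner product of two functionals, linear in the first variable. -/
def dualInner (a b : StrongDual ℂ X) : ℂ := a ((InnerProductSpace.toDual ℂ X).symm b)

theorem dualInner_eq_inner (a b : StrongDual ℂ X) : dualInner a b =
    inner ℂ ((InnerProductSpace.toDual ℂ X).symm a) ((InnerProductSpace.toDual ℂ X).symm b) := by
  rw [InnerProductSpace.toDual_symm_apply, dualInner]

theorem dualInner_conj (a b : StrongDual ℂ X) :
    (starRingEnd ℂ) (dualInner a b) = dualInner b a := by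
  rw [dualInner_eq_inner, dualInner_eq_inner, inner_conj_symm]

@[simp] theorem dualInner_smul_left (r : ℂ) (a c : StrongDual ℂ X) :
    dualInner (r • a) c = r * dualInner a c := rfl

@[simp] theorem dualInner_add_left (a b c : StrongDual ℂ X) :
    dualInner (a + b) c = dualInner a c + dualInner b c := rfl

@[simp] theorem dualInner_add_right (a b c : StrongDual ℂ X) :
    dualInner a (b + c) = dualInner a b + dualInner a c := by
  simp [dualInner]

@[simp] theorem dualInner_smul_right (r : ℂ) (a c : StrongDual ℂ X) :
    dualInner a (r • c) = (starRingEnd ℂ) r * dualInner a c := by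
  rw [dualInner, LinearIsometryEquiv.map_smulₛₗ, map_smul]
  rfl

theorem dualInner_self (a : StrongDual ℂ X) : dualInner a a = ((‖a‖ ^ 2 : ℝ) : ℂ) := by
  rw [dualInner_eq_inner, inner_self_eq_norm_sq_to_K, LinearIsometryEquiv.norm_map]
  norm_cast

theorem dualInner_self_ne_zero {a : StrongDual ℂ X} (ha : a ≠ 0) : dualInner a a ≠ 0 := by
  rw [dualInner_self]
  exact_mod_cast (pow_ne_zero 2 (norm_ne_zero_iff.mpr ha))

/-- The Riesz isomorphism as a real linear map. -/
def rieszReal (X : Type*) [NormedAddCommGroup X] [InnerProductSpace ℂ X] [CompleteSpace X] :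
    StrongDual ℂ X →L[ℝ] X where
  toFun := (InnerProductSpace.toDual ℂ X).symm
  map_add' := map_add _
  map_smul' r x := by
    rw [← Complex.coe_smul, LinearIsometryEquiv.map_smulₛₗ]
    simp
  cont := (InnerProductSpace.toDual ℂ X).symm.continuous

variable {E : Type*} [NormedAddCommGroup E] [NormedSpace ℂ E]
  {a b : E → StrongDual ℂ X} {z : E}

/-- The second slot is conjugate-linear, so the derivative is only real linear; the Wirtinger
derivatives below separate the two summands. -/
theorem exists_hasFDerivAt_dualInner (ha : DifferentiableAt ℂ a z) (hb : DifferentiableAt ℂ b z) :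
    ∃ f' : E →L[ℝ] ℂ, HasFDerivAt (fun w => dualInner (a w) (b w)) f' z ∧
      ∀ v, f' v = dualInner (fderiv ℂ a z v) (b z) + dualInner (a z) (fderiv ℂ b z v) := by
  have h1 : HasFDerivAt (fun w => rieszReal X (a w)) _ z :=
    (rieszReal X).hasFDerivAt.comp z (ha.hasFDerivAt.restrictScalars ℝ)
  have h2 : HasFDerivAt (fun w => rieszReal X (b w)) _ z :=
    (rieszReal X).hasFDerivAt.comp z (hb.hasFDerivAt.restrictScalars ℝ)
  have h3 := h1.inner ℂ h2
  simp only [dualInner_eq_inner]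
  refine ⟨_, h3, fun v => ?_⟩
  rw [ContinuousLinearMap.comp_apply, fderivInnerCLM_apply, add_comm]
  rfl

theorem differentiableAt_real_dualInner (ha : DifferentiableAt ℂ a z)
    (hb : DifferentiableAt ℂ b z) :
    DifferentiableAt ℝ (fun w => dualInner (a w) (b w)) z := by
  obtain ⟨f', hf', -⟩ := exists_hasFDerivAt_dualInner ha hb
  exact hf'.differentiableAt

theorem dHol_dualInner (ha : DifferentiableAt ℂ a z) (hb : DifferentiableAt ℂ b z) (v : E) :
    dHol (fun w => dualInner (a w) (b w)) z v = dualInner (fderiv ℂ a z v) (b z) := by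
  obtain ⟨f', hf', h⟩ := exists_hasFDerivAt_dualInner ha hb
  rw [dHol, hf'.fderiv, h, h, map_smul, map_smul, dualInner_smul_left, dualInner_smul_right]
  simp only [smul_eq_mul, Complex.conj_I]
  linear_combination (-2⁻¹ * dualInner (fderiv ℂ a z v) (b z) +
    2⁻¹ * dualInner (a z) (fderiv ℂ b z v)) * Complex.I_sq

theorem dBar_dualInner (ha : DifferentiableAt ℂ a z) (hb : DifferentiableAt ℂ b z) (v : E) :
    dBar (fun w => dualInner (a w) (b w)) z v = dualInner (a z) (fderiv ℂ b z v) := by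
  obtain ⟨f', hf', h⟩ := exists_hasFDerivAt_dualInner ha hb
  rw [dBar, hf'.fderiv, h, h, map_smul, map_smul, dualInner_smul_left, dualInner_smul_right]
  simp only [smul_eq_mul, Complex.conj_I]
  linear_combination (2⁻¹ * dualInner (fderiv ℂ a z v) (b z) -
    2⁻¹ * dualInner (a z) (fderiv ℂ b z v)) * Complex.I_sq

end DualInner

section Wirtinger

variable {E : Type*} [NormedAddCommGroup E] [NormedSpace ℂ E] {f g : E → ℂ} {z : E}

theorem Filter.EventuallyEq.dBar_eq {F : Type*} [NormedAddCommGroup F] [NormedSpace ℂ F]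
    {f g : E → F} (h : f =ᶠ[𝓝 z] g) (v : E) : dBar f z v = dBar g z v := by
  rw [dBar, dBar, h.fderiv_eq]

theorem Filter.EventuallyEq.dHol_eq {F : Type*} [NormedAddCommGroup F] [NormedSpace ℂ F]
    {f g : E → F} (h : f =ᶠ[𝓝 z] g) (v : E) : dHol f z v = dHol g z v := by
  rw [dHol, dHol, h.fderiv_eq]

theorem dBar_mul (hf : DifferentiableAt ℝ f z) (hg : DifferentiableAt ℝ g z) (v : E) :
    dBar (fun w => f w * g w) z v = f z * dBar g z v + g z * dBar f z v := by
  simp only [dBar, fderiv_fun_mul hf hg]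
  simp
  ring

theorem hasFDerivAt_inv_of_ne_zero {𝕜 : Type*} [NontriviallyNormedField 𝕜] [NormedAlgebra 𝕜 ℂ]
    {E : Type*} [NormedAddCommGroup E] [NormedSpace 𝕜 E] {f : E → ℂ} {z : E} {f' : E →L[𝕜] ℂ}
    (hf : HasFDerivAt f f' z) (h0 : f z ≠ 0) :
    HasFDerivAt (fun w => (f w)⁻¹) (-((f z) ^ 2)⁻¹ • f') z :=
  (hasDerivAt_inv h0).comp_hasFDerivAt z hf

theorem dBar_inv (hf : DifferentiableAt ℝ f z) (h0 : f z ≠ 0) (v : E) :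
    dBar (fun w => (f w)⁻¹) z v = -((f z) ^ 2)⁻¹ * dBar f z v := by
  simp only [dBar, (hasFDerivAt_inv_of_ne_zero hf.hasFDerivAt h0).fderiv]
  simp
  ring

theorem hasFDerivAt_div_of_ne_zero {f g : E → ℂ} {f' g' : E →L[ℂ] ℂ}
    (hf : HasFDerivAt f f' z) (hg : HasFDerivAt g g' z) (h0 : g z ≠ 0) :
    HasFDerivAt (fun w => f w / g w) ((g z)⁻¹ • f' - (f z / g z ^ 2) • g') z := by
  have h := hf.mul (hasFDerivAt_inv_of_ne_zero hg h0)
  simp only [div_eq_mul_inv]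
  refine h.congr_fderiv ?_
  ext v
  simp
  ring

end Wirtinger

/-! ### The polarized curvature -/

section Curvature

variable {X : Type*} [NormedAddCommGroup X] [InnerProductSpace ℂ X] [CompleteSpace X]
  {E : Type*} [NormedAddCommGroup E] [NormedSpace ℂ E]

/-- The polarized curvature of the metric `⟨e, e⟩`. -/
def polarCurvature (e : E → StrongDual ℂ X) (z w v u : E) : ℂ :=
  dualInner (fderiv ℂ e z v) (fderiv ℂ e w u) / dualInner (e z) (e w) -
    dualInner (fderiv ℂ e z v) (e w) * dualInner (e z) (fderiv ℂ e w u) /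
      dualInner (e z) (e w) ^ 2

theorem polarCurvature_conj (e : E → StrongDual ℂ X) (z w v u : E) :
    (starRingEnd ℂ) (polarCurvature e z w v u) = polarCurvature e w z u v := by
  simp only [polarCurvature, map_sub, map_div₀, map_mul, map_pow, dualInner_conj]
  ring

theorem polarCurvature_add_left (e : E → StrongDual ℂ X) (z w v v' u : E) :
    polarCurvature e z w (v + v') u = polarCurvature e z w v u + polarCurvature e z w v' u := by
  simp only [polarCurvature, map_add, dualInner_add_left]
  ring

theorem polarCurvature_smul_left (e : E → StrongDual ℂ X) (z w v u : E) (c : ℂ) :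
    polarCurvature e z w (c • v) u = c * polarCurvature e z w v u := by
  simp only [polarCurvature, map_smul, dualInner_smul_left]
  ring

theorem polarCurvature_add_right (e : E → StrongDual ℂ X) (z w v u u' : E) :
    polarCurvature e z w v (u + u') = polarCurvature e z w v u + polarCurvature e z w v u' := by
  simp only [polarCurvature, map_add, dualInner_add_right]
  ring

theorem polarCurvature_smul_right (e : E → StrongDual ℂ X) (z w v u : E) (c : ℂ) :
    polarCurvature e z w v (c • u) = (starRingEnd ℂ) c * polarCurvature e z w v u := by
  simp only [polarCurvature, map_smul, dualInner_smul_right]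
  ring

theorem dBar_inv_mul_dualInner {e a : E → StrongDual ℂ X} {z : E} (he : DifferentiableAt ℂ e z)
    (ha : DifferentiableAt ℂ a z) (h0 : e z ≠ 0) (u : E) :
    dBar (fun w => (dualInner (e w) (e w))⁻¹ * dualInner (a w) (e w)) z u =
      dualInner (a z) (fderiv ℂ e z u) / dualInner (e z) (e z) -
        dualInner (a z) (e z) * dualInner (e z) (fderiv ℂ e z u) / dualInner (e z) (e z) ^ 2 := by
  have h1 := differentiableAt_real_dualInner he he
  have h2 := differentiableAt_real_dualInner ha he
  have h3 := dualInner_self_ne_zero h0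
  have h4 : DifferentiableAt ℝ (fun w => (dualInner (e w) (e w))⁻¹) z :=
    (hasFDerivAt_inv_of_ne_zero h1.hasFDerivAt h3).differentiableAt
  rw [dBar_mul h4 h2, dBar_inv h1 h3, dBar_dualInner he he, dBar_dualInner ha he]
  ring

/-- `∂` falls on the first slot and `∂̄` on the second. The directions change places because
`polarCurvature` lists the holomorphic one first. -/
theorem curvature_dualInner {m : ℕ} {e : EuclideanSpace ℂ (Fin m) → StrongDual ℂ X}
    {z : EuclideanSpace ℂ (Fin m)} (he : AnalyticAt ℂ e z) (h0 : e z ≠ 0)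
    (u v : EuclideanSpace ℂ (Fin m)) :
    curvature (fun w => dualInner (e w) (e w)) z u v = polarCurvature e z z v u := by
  rw [curvature]
  have h1 : (fun w => (dualInner (e w) (e w))⁻¹ * dHol (fun w => dualInner (e w) (e w)) w v)
      =ᶠ[𝓝 z] fun w => (dualInner (e w) (e w))⁻¹ * dualInner (fderiv ℂ e w v) (e w) := by
    filter_upwards [he.eventually_analyticAt] with w hw
    rw [dHol_dualInner hw.differentiableAt hw.differentiableAt]
  rw [h1.dBar_eq, dBar_inv_mul_dualInner (a := fun w => fderiv ℂ e w v) he.differentiableAt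
    (he.fderiv.differentiableAt.clm_apply (differentiableAt_const v)) h0]
  rfl

end Curvature

/-! ### Extension from the diagonal -/

section Polarization

open Metric

variable {B : Type*} [NormedAddCommGroup B] [NormedSpace ℂ B]

/-- A sesquiholomorphic function vanishing on the diagonal vanishes. -/
theorem eq_zero_of_eq_zero_on_diagonal {D : Set B} (hD : IsOpen D) (hDc : Convex ℝ D)
    {S : B → B → ℂ}
    (hS : ∀ α β, ∀ τ : ℂ, α + τ • β ∈ D → α + (starRingEnd ℂ) τ • β ∈ D →
      DifferentiableAt ℂ (fun τ : ℂ => S (α + τ • β) (α + (starRingEnd ℂ) τ • β)) τ)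
    (h0 : ∀ x ∈ D, S x x = 0) {x y : B} (hx : x ∈ D) (hy : y ∈ D) : S x y = 0 := by
  set α : B := (2⁻¹ : ℝ) • x + (2⁻¹ : ℝ) • y
  set β : B := (-(Complex.I / 2)) • (x - y)
  have hα : α ∈ D := hDc hx hy (by norm_num) (by norm_num) (by norm_num)
  have hαβ : α + Complex.I • β = x := by
    simp only [α, β, smul_smul, ← Complex.coe_smul]
    have : Complex.I * -(Complex.I / 2) = 2⁻¹ := by
      linear_combination (-2⁻¹ : ℂ) * Complex.I_sq
    rw [this]
    push_cast
    module
  have hαβ' : α + (starRingEnd ℂ) Complex.I • β = y := by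
    simp only [α, β, smul_smul, ← Complex.coe_smul, Complex.conj_I]
    have : -Complex.I * -(Complex.I / 2) = -2⁻¹ := by
      linear_combination (2⁻¹ : ℂ) * Complex.I_sq
    rw [this]
    push_cast
    module
  let ℓ : ℂ → B := fun τ => α + τ • β
  have hℓ : Continuous ℓ := by fun_prop
  let W : Set ℂ := ℓ ⁻¹' D ∩ (fun τ => ℓ ((starRingEnd ℂ) τ)) ⁻¹' D
  have hWo : IsOpen W :=
    (hD.preimage hℓ).inter (hD.preimage (hℓ.comp Complex.continuous_conj))
  have hcomb : ∀ (a b : ℝ), a + b = 1 → ∀ s t : ℂ, ℓ (a • s + b • t) = a • ℓ s + b • ℓ t := by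
    intro a b hab s t
    simp only [ℓ, ← Complex.coe_smul]
    have hab' : (a : ℂ) + b = 1 := by exact_mod_cast hab
    have : α = ((a : ℂ) + b) • α := by rw [hab', one_smul]
    rw [this, hab']
    simp only [smul_eq_mul, one_smul]
    nth_rewrite 1 [this]
    module
  have hWc : Convex ℝ W := by
    intro s hs t ht a b ha hb hab
    refine ⟨?_, ?_⟩
    · rw [mem_preimage, hcomb a b hab]
      exact hDc hs.1 ht.1 ha hb hab
    · have h1 : (starRingEnd ℂ) (a • s + b • t) =
          a • (starRingEnd ℂ) s + b • (starRingEnd ℂ) t := by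
        simp
      rw [mem_preimage, h1, hcomb a b hab]
      exact hDc hs.2 ht.2 ha hb hab
  have hW0 : (0 : ℂ) ∈ W := by
    refine ⟨?_, ?_⟩ <;> simpa [ℓ] using hα
  have hWI : Complex.I ∈ W := ⟨by rw [mem_preimage]; simp only [ℓ]; rwa [hαβ],
    by rw [mem_preimage]; simp only [ℓ]; rwa [hαβ']⟩
  have hdiff : DifferentiableOn ℂ (fun τ : ℂ => S (ℓ τ) (ℓ ((starRingEnd ℂ) τ))) W :=
    fun τ hτ => (hS α β τ hτ.1 hτ.2).differentiableWithinAt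
  have hfreq : ∃ᶠ τ in 𝓝[≠] (0 : ℂ), S (ℓ τ) (ℓ ((starRingEnd ℂ) τ)) = 0 := by
    have ht : Tendsto (fun r : ℝ => (r : ℂ)) (𝓝[≠] 0) (𝓝[≠] 0) := by
      refine tendsto_nhdsWithin_iff.mpr ⟨?_, ?_⟩
      · exact (Complex.continuous_ofReal.tendsto' 0 0 (by simp)).mono_left nhdsWithin_le_nhds
      · filter_upwards [self_mem_nhdsWithin] with r hr
        simpa using hr
    refine ht.frequently (Eventually.frequently ?_)
    have hr : ∀ᶠ r : ℝ in 𝓝[≠] 0, (r : ℂ) ∈ W :=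
      (ht.mono_right nhdsWithin_le_nhds).eventually (hWo.mem_nhds hW0)
    filter_upwards [hr] with r hr
    rw [Complex.conj_ofReal]
    exact h0 _ hr.1
  have := (hdiff.analyticOnNhd hWo).eqOn_zero_of_preconnected_of_frequently_eq_zero
    hWc.isPreconnected hW0 hfreq hWI
  simp only [ℓ, Pi.zero_apply] at this
  rwa [hαβ, hαβ'] at this

variable {X : Type*} [NormedAddCommGroup X] [InnerProductSpace ℂ X] [CompleteSpace X]

/-- The conjugation of the parameter cancels the conjugate-linearity of the Riesz map. -/
theorem differentiableAt_dualInner_conj {a b : ℂ → StrongDual ℂ X} {τ : ℂ}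
    (ha : DifferentiableAt ℂ a τ) (hb : DifferentiableAt ℂ b ((starRingEnd ℂ) τ)) :
    DifferentiableAt ℂ (fun t => dualInner (a t) (b ((starRingEnd ℂ) t))) τ := by
  have h1 : DifferentiableAt ℂ (fun t => (InnerProductSpace.toDual ℂ X).symm
      (b ((starRingEnd ℂ) t))) τ :=
    DifferentiableAt.comp_semilinear₂
      ((InnerProductSpace.toDual ℂ X).symm.toContinuousLinearEquiv : StrongDual ℂ X →L⋆[ℂ] X)
      ((starL ℂ : ℂ ≃L⋆[ℂ] ℂ) : ℂ →L⋆[ℂ] ℂ) hb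
  exact ha.clm_apply h1

end Polarization

/-! ### Curvature along a submanifold determines the normalized kernel -/

section Rigidity

variable {X X' : Type*} [NormedAddCommGroup X] [InnerProductSpace ℂ X] [CompleteSpace X]
  [NormedAddCommGroup X'] [InnerProductSpace ℂ X'] [CompleteSpace X']
  {E B : Type*} [NormedAddCommGroup E] [NormedSpace ℂ E] [NormedAddCommGroup B] [NormedSpace ℂ B]
  {V : Set E} {D : Set B} {F : B → E}

theorem differentiableAt_polarCurvature_conj {e : E → StrongDual ℂ X} (he : AnalyticOnNhd ℂ e V)
    {a b : ℂ → E} {τ : ℂ} (ha : DifferentiableAt ℂ a τ)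
    (hb : DifferentiableAt ℂ b ((starRingEnd ℂ) τ)) (haV : a τ ∈ V)
    (hbV : b ((starRingEnd ℂ) τ) ∈ V)
    (h0 : dualInner (e (a τ)) (e (b ((starRingEnd ℂ) τ))) ≠ 0) (v u : E) :
    DifferentiableAt ℂ (fun t => polarCurvature e (a t) (b ((starRingEnd ℂ) t)) v u) τ := by
  have h1 : DifferentiableAt ℂ (fun t => e (a t)) τ :=
    (he _ haV).differentiableAt.comp τ ha
  have h2 : DifferentiableAt ℂ (fun t => e (b t)) ((starRingEnd ℂ) τ) :=
    (he _ hbV).differentiableAt.comp _ hb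
  have h3 : DifferentiableAt ℂ (fun t => fderiv ℂ e (a t) v) τ :=
    ((he _ haV).fderiv.differentiableAt.comp τ ha).clm_apply (differentiableAt_const v)
  have h4 : DifferentiableAt ℂ (fun t => fderiv ℂ e (b t) u) ((starRingEnd ℂ) τ) :=
    ((he _ hbV).fderiv.differentiableAt.comp _ hb).clm_apply (differentiableAt_const u)
  have h11 := differentiableAt_dualInner_conj h1 h2
  simp only [polarCurvature]
  exact ((differentiableAt_dualInner_conj h3 h4).div h11 h0).sub
    (((differentiableAt_dualInner_conj h3 h2).mul (differentiableAt_dualInner_conj h1 h4)).div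
      (h11.pow 2) (pow_ne_zero 2 h0))

theorem hasFDerivAt_dualInner_left {e : E → StrongDual ℂ X} {b : StrongDual ℂ X} {x : B}
    {F' : B →L[ℂ] E} (he : DifferentiableAt ℂ e (F x)) (hF : HasFDerivAt F F' x) :
    HasFDerivAt (fun x => dualInner (e (F x)) b)
      (((ContinuousLinearMap.apply ℂ ℂ ((InnerProductSpace.toDual ℂ X).symm b)).comp
        (fderiv ℂ e (F x))).comp F') x :=
  (((ContinuousLinearMap.apply ℂ ℂ
    ((InnerProductSpace.toDual ℂ X).symm b)).hasFDerivAt).comp x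
    (he.hasFDerivAt.comp x hF) : _)

/-- For `c = e w` and `b = ∂_u e w` the quotient is the logarithmic derivative `∂̄_u log K(·, w)`,
and its derivative is the polarized curvature. -/
theorem hasFDerivAt_dualInner_div {e : E → StrongDual ℂ X} {b c : StrongDual ℂ X} {x : B}
    {F' : B →L[ℂ] E} (he : DifferentiableAt ℂ e (F x)) (hF : HasFDerivAt F F' x)
    (h0 : dualInner (e (F x)) c ≠ 0) :
    ∃ T : B →L[ℂ] ℂ, HasFDerivAt (fun x => dualInner (e (F x)) b / dualInner (e (F x)) c) T x ∧
      ∀ η, T η = dualInner (fderiv ℂ e (F x) (F' η)) b / dualInner (e (F x)) c -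
        dualInner (fderiv ℂ e (F x) (F' η)) c * dualInner (e (F x)) b /
          dualInner (e (F x)) c ^ 2 := by
  refine ⟨_, hasFDerivAt_div_of_ne_zero (hasFDerivAt_dualInner_left he hF)
    (hasFDerivAt_dualInner_left he hF) h0, fun η => ?_⟩
  simp [dualInner]
  ring

/-- Two holomorphic families of functionals whose metrics have the same curvature along a complex
submanifold, and which agree against a base point, have the same first order Gram matrices along
the submanifold. -/
theorem gram_eq_of_polarCurvature_eq {e : E → StrongDual ℂ X} {e' : E → StrongDual ℂ X'}
    (he : AnalyticOnNhd ℂ e V) (he' : AnalyticOnNhd ℂ e' V) (hV : IsOpen V)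
    (hD : IsOpen D) (hDc : Convex ℝ D) (hF : DifferentiableOn ℂ F D) (hFV : MapsTo F D V)
    {o : B} (ho : o ∈ D)
    (h0 : ∀ x ∈ D, ∀ y ∈ D, dualInner (e (F x)) (e (F y)) ≠ 0)
    (h0' : ∀ x ∈ D, ∀ y ∈ D, dualInner (e' (F x)) (e' (F y)) ≠ 0)
    (hnorm : ∀ z ∈ V, dualInner (e z) (e (F o)) = dualInner (e' z) (e' (F o)))
    (hcurv : ∀ x ∈ D, ∀ v u, polarCurvature e (F x) (F x) v u = polarCurvature e' (F x) (F x) v u)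
    {x y : B} (hx : x ∈ D) (hy : y ∈ D) :
    dualInner (e (F x)) (e (F y)) = dualInner (e' (F x)) (e' (F y)) ∧
    (∀ v, dualInner (fderiv ℂ e (F x) v) (e (F y)) =
      dualInner (fderiv ℂ e' (F x) v) (e' (F y))) ∧
    ∀ v u, dualInner (fderiv ℂ e (F x) v) (fderiv ℂ e (F y) u) =
      dualInner (fderiv ℂ e' (F x) v) (fderiv ℂ e' (F y) u) := by
  have hFd : ∀ x ∈ D, DifferentiableAt ℂ F x := fun x hx => hF.differentiableAt (hD.mem_nhds hx)
  have hpol : ∀ x ∈ D, ∀ y ∈ D, ∀ v u,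
      polarCurvature e (F x) (F y) v u = polarCurvature e' (F x) (F y) v u := by
    intro x hx y hy v u
    rw [← sub_eq_zero]
    refine eq_zero_of_eq_zero_on_diagonal
      (S := fun x y => polarCurvature e (F x) (F y) v u - polarCurvature e' (F x) (F y) v u)
      hD hDc ?_ (fun x hx => sub_eq_zero.mpr (hcurv x hx v u)) hx hy
    intro α β τ h1 h2
    have ha : DifferentiableAt ℂ (fun t : ℂ => F (α + t • β)) τ :=
      (hFd _ h1).comp τ (f := fun t : ℂ => α + t • β) (by fun_prop)
    have hb : DifferentiableAt ℂ (fun t : ℂ => F (α + t • β)) ((starRingEnd ℂ) τ) :=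
      (hFd _ h2).comp _ (f := fun t : ℂ => α + t • β) (by fun_prop)
    exact (differentiableAt_polarCurvature_conj he ha hb (hFV h1) (hFV h2) (h0 _ h1 _ h2) v u).sub
      (differentiableAt_polarCurvature_conj he' ha hb (hFV h1) (hFV h2) (h0' _ h1 _ h2) v u)
  -- The normalization holds on an open set of the ambient space, so it may be differentiated in
  -- directions transverse to the submanifold as well.
  have hnorm' : ∀ z ∈ V, ∀ v, dualInner (fderiv ℂ e z v) (e (F o)) =
      dualInner (fderiv ℂ e' z v) (e' (F o)) := by
    intro z hz v
    have h1 := hasFDerivAt_dualInner_left (b := e (F o)) (F := id) (he z hz).differentiableAt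
      (hasFDerivAt_id z)
    have h2 := hasFDerivAt_dualInner_left (b := e' (F o)) (F := id) (he' z hz).differentiableAt
      (hasFDerivAt_id z)
    have h3 := h1.unique (h2.congr_of_eventuallyEq (by
      filter_upwards [hV.mem_nhds hz] with w hw using hnorm w hw))
    exact DFunLike.congr_fun h3 v
  -- the logarithmic derivatives in the second variable agree
  have hlog : ∀ y ∈ D, ∀ u, ∀ x ∈ D,
      dualInner (e (F x)) (fderiv ℂ e (F y) u) / dualInner (e (F x)) (e (F y)) =
      dualInner (e' (F x)) (fderiv ℂ e' (F y) u) / dualInner (e' (F x)) (e' (F y)) := by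
    intro y hy u
    have hd1 := fun x (hx : x ∈ D) => hasFDerivAt_dualInner_div (b := fderiv ℂ e (F y) u)
      (he _ (hFV hx)).differentiableAt (hFd x hx).hasFDerivAt (h0 x hx y hy)
    have hd2 := fun x (hx : x ∈ D) => hasFDerivAt_dualInner_div (b := fderiv ℂ e' (F y) u)
      (he' _ (hFV hx)).differentiableAt (hFd x hx).hasFDerivAt (h0' x hx y hy)
    -- As functions of `x`, both sides have the polarized curvature as derivative, and at `x = o`
    -- they agree by the normalization.
    refine hD.eqOn_of_fderiv_eq hDc.isPreconnected (𝕜 := ℂ) (x := o) ?_ ?_ ?_ ho ?_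
    · intro x hx
      obtain ⟨T, hT, -⟩ := hd1 x hx
      exact hT.differentiableAt.differentiableWithinAt
    · intro x hx
      obtain ⟨T, hT, -⟩ := hd2 x hx
      exact hT.differentiableAt.differentiableWithinAt
    · intro x hx
      obtain ⟨T, hT, hTη⟩ := hd1 x hx
      obtain ⟨T', hT', hTη'⟩ := hd2 x hx
      rw [hT.fderiv, hT'.fderiv]
      ext η
      rw [hTη, hTη']
      exact hpol x hx y hy (fderiv ℂ F x η) u
    · rw [← dualInner_conj (fderiv ℂ e (F y) u), ← dualInner_conj (fderiv ℂ e' (F y) u),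
        ← dualInner_conj (e (F y)), ← dualInner_conj (e' (F y)), hnorm _ (hFV hy),
        hnorm' _ (hFV hy)]
  have hlog' : ∀ y ∈ D, ∀ x ∈ D, ∀ u,
      dualInner (fderiv ℂ e (F x) u) (e (F y)) / dualInner (e (F x)) (e (F y)) =
      dualInner (fderiv ℂ e' (F x) u) (e' (F y)) / dualInner (e' (F x)) (e' (F y)) := by
    intro y hy x hx u
    have := congrArg (starRingEnd ℂ) (hlog x hx u y hy)
    simpa only [map_div₀, dualInner_conj] using this
  -- Second integration: equal logarithmic derivatives make the quotient of the kernels constant in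
  -- `x`, and it is `1` at `o`.
  have hK : ∀ y ∈ D, ∀ x ∈ D,
      dualInner (e (F x)) (e (F y)) / dualInner (e' (F x)) (e' (F y)) = 1 := by
    intro y hy
    have hd := fun x (hx : x ∈ D) => hasFDerivAt_div_of_ne_zero
      (hasFDerivAt_dualInner_left (b := e (F y)) (he _ (hFV hx)).differentiableAt
        (hFd x hx).hasFDerivAt)
      (hasFDerivAt_dualInner_left (b := e' (F y)) (he' _ (hFV hx)).differentiableAt
        (hFd x hx).hasFDerivAt) (h0' x hx y hy)
    refine hD.eqOn_of_fderiv_eq hDc.isPreconnected (𝕜 := ℂ) (x := o) (g := fun _ => (1 : ℂ))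
      ?_ ?_ ?_ ho ?_
    · exact fun x hx => (hd x hx).differentiableAt.differentiableWithinAt
    · exact differentiableOn_const _
    · intro x hx
      rw [(hd x hx).fderiv]
      ext η
      have h1 := hlog' y hy x hx (fderiv ℂ F x η)
      have h2 := h0 x hx y hy
      have h3 := h0' x hx y hy
      rw [div_eq_div_iff h2 h3] at h1
      simp only [dualInner] at h1 h2 h3 ⊢
      simp
      field_simp
      linear_combination h1
    · have h1 : dualInner (e (F o)) (e (F y)) = dualInner (e' (F o)) (e' (F y)) := by
        rw [← dualInner_conj (e (F y)), ← dualInner_conj (e' (F y)), hnorm _ (hFV hy)]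
      rw [h1, div_self (h0' o ho y hy)]
  have hKeq : ∀ y ∈ D, ∀ x ∈ D, dualInner (e (F x)) (e (F y)) = dualInner (e' (F x)) (e' (F y)) :=
    fun y hy x hx => (div_eq_one_iff_eq (h0' x hx y hy)).mp (hK y hy x hx)
  have hleft : ∀ v, dualInner (fderiv ℂ e (F x) v) (e (F y)) =
      dualInner (fderiv ℂ e' (F x) v) (e' (F y)) := by
    intro v
    have h1 := hlog' y hy x hx v
    rw [hKeq y hy x hx] at h1
    exact (div_left_inj' (h0' x hx y hy)).mp h1
  have hright : ∀ u, dualInner (e (F x)) (fderiv ℂ e (F y) u) =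
      dualInner (e' (F x)) (fderiv ℂ e' (F y) u) := by
    intro u
    have h1 := hlog y hy u x hx
    rw [hKeq y hy x hx] at h1
    exact (div_left_inj' (h0' x hx y hy)).mp h1
  refine ⟨hKeq y hy x hx, hleft, fun v u => ?_⟩
  -- All terms of the curvature except the mixed derivative of the kernel are now known to agree.
  have h1 := hpol x hx y hy v u
  simp only [polarCurvature, hKeq y hy x hx, hleft, hright] at h1
  exact (div_left_inj' (h0' x hx y hy)).mp (sub_left_injective h1)

end Rigidity

/-! ### Invariance of the curvature under change of frame -/

section Gauge

/-- `K`, `A`, `B`, `C` stand for `⟨e, e⟩`, `⟨∂_v e, e⟩`, `⟨e, ∂_u e⟩`, `⟨∂_v e, ∂_u e⟩`; the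
substitution is `e ↦ s e`, `∂_v e ↦ s ∂_v e + t e`, with primes for the conjugated coefficients in
the second slot. Stated for numbers at one point, it serves both for holomorphic factors and for
module isomorphisms. -/
theorem curvature_gauge {s s' t t' K A B C : ℂ} (hs : s ≠ 0) (hs' : s' ≠ 0) (hK : K ≠ 0) :
    (s * s' * C + s * t' * A + t * s' * B + t * t' * K) / (s * s' * K) -
      (s * s' * A + t * s' * K) * (s * s' * B + s * t' * K) / (s * s' * K) ^ 2 =
    C / K - A * B / K ^ 2 := by
  field_simp
  ring

theorem fderiv_fun_smul_apply {E G : Type*} [NormedAddCommGroup E] [NormedSpace ℂ E]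
    [NormedAddCommGroup G] [NormedSpace ℂ G] {c : E → ℂ} {e : E → G} {z : E}
    (hc : DifferentiableAt ℂ c z) (he : DifferentiableAt ℂ e z) (v : E) :
    fderiv ℂ (fun w => c w • e w) z v = c z • fderiv ℂ e z v + fderiv ℂ c z v • e z := by
  exact DFunLike.congr_fun (hc.hasFDerivAt.smul he.hasFDerivAt).fderiv v

variable {X : Type*} [NormedAddCommGroup X] [InnerProductSpace ℂ X] [CompleteSpace X]
  {E : Type*} [NormedAddCommGroup E] [NormedSpace ℂ E]

theorem polarCurvature_smul {c : E → ℂ} {e : E → StrongDual ℂ X} {z : E}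
    (hc : DifferentiableAt ℂ c z) (he : DifferentiableAt ℂ e z) (hcz : c z ≠ 0) (hez : e z ≠ 0)
    (v u : E) :
    polarCurvature (fun w => c w • e w) z z v u = polarCurvature e z z v u := by
  have hc' : (starRingEnd ℂ) (c z) ≠ 0 := by simpa using hcz
  rw [polarCurvature, polarCurvature, ← curvature_gauge (t := fderiv ℂ c z v)
    (t' := (starRingEnd ℂ) (fderiv ℂ c z u)) hcz hc' (dualInner_self_ne_zero hez)]
  simp only [fderiv_fun_smul_apply hc he, dualInner_add_left, dualInner_add_right,
    dualInner_smul_left, dualInner_smul_right]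
  ring

end Gauge

/-! ### Normalization at a base point of the hypersurface -/

section LocalGram

variable {X X' : Type*} [NormedAddCommGroup X] [InnerProductSpace ℂ X] [CompleteSpace X]
  [NormedAddCommGroup X'] [InnerProductSpace ℂ X'] [CompleteSpace X']

/-- The kernel is continuous and nonzero at `(p, p)`. The same neighbourhood serves both variables,
since the rigidity argument divides by off-diagonal values. -/
theorem eventually_dualInner_ne_zero {E : Type*} [NormedAddCommGroup E] [NormedSpace ℂ E]
    {e : E → StrongDual ℂ X} {p : E} (he : ContinuousAt e p) (h0 : e p ≠ 0) :
    ∃ V ∈ 𝓝 p, ∀ z ∈ V, ∀ w ∈ V, dualInner (e z) (e w) ≠ 0 := by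
  have hcont : ContinuousAt (fun q : E × E => dualInner (e q.1) (e q.2)) (p, p) := by
    simp only [dualInner_eq_inner]
    have h1 : ContinuousAt (fun q : E × E => e q.1) (p, p) := he.comp_of_eq continuousAt_fst rfl
    have h2 : ContinuousAt (fun q : E × E => e q.2) (p, p) := he.comp_of_eq continuousAt_snd rfl
    have hJ := (InnerProductSpace.toDual ℂ X).symm.continuous
    exact ContinuousAt.inner (𝕜 := ℂ) (hJ.continuousAt.comp h1) (hJ.continuousAt.comp h2)
  have hev := hcont.eventually_ne (dualInner_self_ne_zero h0)
  rw [nhds_prod_eq] at hev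
  obtain ⟨t, ht, h⟩ := (Filter.eventually_prod_self_iff
    (r := fun z w => dualInner (e z) (e w) ≠ 0)).mp hev
  exact ⟨t, ht, h⟩

variable {m : ℕ} {Ω Z : Set (EuclideanSpace ℂ (Fin m))} {p : EuclideanSpace ℂ (Fin m)}

theorem IsHypersurface.exists_gram_eq (hZ : IsHypersurface Ω Z)
    {e : EuclideanSpace ℂ (Fin m) → StrongDual ℂ X}
    {e' : EuclideanSpace ℂ (Fin m) → StrongDual ℂ X'}
    (hΩ : IsOpen Ω) (he : AnalyticOnNhd ℂ e Ω) (he' : AnalyticOnNhd ℂ e' Ω)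
    (h0 : ∀ z ∈ Ω, e z ≠ 0) (h0' : ∀ z ∈ Ω, e' z ≠ 0) (hp : p ∈ Z)
    (hcurv : ∀ z ∈ Z, ∀ v u, polarCurvature e z z v u = polarCurvature e' z z v u) :
    ∃ (c : EuclideanSpace ℂ (Fin m) → ℂ) (W : Set (EuclideanSpace ℂ (Fin m))), W ∈ 𝓝 p ∧ W ⊆ Ω ∧
      (∀ z ∈ W, AnalyticAt ℂ c z ∧ c z ≠ 0) ∧
      ∀ z ∈ Z ∩ W, ∀ w ∈ Z ∩ W,
        dualInner (e z) (e w) = dualInner (c z • e' z) (c w • e' w) ∧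
        (∀ v, dualInner (fderiv ℂ e z v) (e w) =
          dualInner (fderiv ℂ (fun x => c x • e' x) z v) (c w • e' w)) ∧
        ∀ v u, dualInner (fderiv ℂ e z v) (fderiv ℂ e w u) =
          dualInner (fderiv ℂ (fun x => c x • e' x) z v)
            (fderiv ℂ (fun x => c x • e' x) w u) := by
  have hpΩ : p ∈ Ω := hZ.1 hp
  obtain ⟨V₁, hV₁, hne⟩ := eventually_dualInner_ne_zero (he p hpΩ).continuousAt (h0 p hpΩ)
  obtain ⟨V₂, hV₂, hne'⟩ := eventually_dualInner_ne_zero (he' p hpΩ).continuousAt (h0' p hpΩ)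
  obtain ⟨V, hVs, hV, hpV⟩ := mem_nhds_iff.mp
    (inter_mem (inter_mem hV₁ hV₂) (hΩ.mem_nhds hpΩ))
  have hVΩ : V ⊆ Ω := fun z hz => (hVs hz).2
  replace hne : ∀ z ∈ V, ∀ w ∈ V, dualInner (e z) (e w) ≠ 0 :=
    fun z hz w hw => hne z (hVs hz).1.1 w (hVs hw).1.1
  replace hne' : ∀ z ∈ V, ∀ w ∈ V, dualInner (e' z) (e' w) ≠ 0 :=
    fun z hz w hw => hne' z (hVs hz).1.2 w (hVs hw).1.2
  obtain ⟨ρ, hρ, hρ2⟩ : ∃ ρ : ℝ, ρ ≠ 0 ∧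
      dualInner (e p) (e p) / dualInner (e' p) (e' p) = (ρ : ℂ) * ρ := by
    have h1 := norm_ne_zero_iff.mpr (h0 p hpΩ)
    have h2 := norm_ne_zero_iff.mpr (h0' p hpΩ)
    refine ⟨‖e p‖ / ‖e' p‖, div_ne_zero h1 h2, ?_⟩
    rw [dualInner_self, dualInner_self]
    push_cast
    ring
  have hρ' : (ρ : ℂ) ≠ 0 := by exact_mod_cast hρ
  -- The quotient of the kernels against `p` makes these proportional; dividing by the real square
  -- root `ρ` of its value at `p` gives `c p = ρ`, which cancels the factor `conj (c p)` from the
  -- second slot.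
  let c : EuclideanSpace ℂ (Fin m) → ℂ := fun z =>
    dualInner (e z) (e p) / dualInner (e' z) (e' p) / ρ
  have hcp : c p = ρ := by
    simp only [c, hρ2]
    field_simp
  have hc : ∀ z ∈ V, AnalyticAt ℂ c z := by
    intro z hz
    refine AnalyticAt.div (AnalyticAt.div ?_ ?_ (hne' z hz p hpV)) analyticAt_const hρ'
    · exact ((ContinuousLinearMap.apply ℂ ℂ
        ((InnerProductSpace.toDual ℂ X).symm (e p))).analyticAt _).comp (he z (hVΩ hz))
    · exact ((ContinuousLinearMap.apply ℂ ℂ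
        ((InnerProductSpace.toDual ℂ X').symm (e' p))).analyticAt _).comp (he' z (hVΩ hz))
  have hc0 : ∀ z ∈ V, c z ≠ 0 := fun z hz =>
    div_ne_zero (div_ne_zero (hne z hz p hpV) (hne' z hz p hpV)) hρ'
  obtain ⟨U, φ, hφ, hpU⟩ := hZ.2 p hp
  obtain ⟨F, hF, hF0, hFZ, -, hFW⟩ := hφ.exists_parametrization hpU hp
  have hFV : ∀ᶠ x in 𝓝 0, F x ∈ V := by
    refine hF.continuousAt.eventually_mem ?_
    rw [hF0]; exact hV.mem_nhds hpV
  obtain ⟨ε, hε, hball⟩ := Metric.nhds_basis_ball.eventually_iff.mp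
    (hF.eventually_analyticAt.and (hFZ.and hFV))
  obtain ⟨W, hW, hWF⟩ := mem_nhdsWithin_iff_exists_mem_nhds_inter.mp
    (hFW _ (Metric.ball_mem_nhds 0 hε))
  refine ⟨c, W ∩ V, inter_mem hW (hV.mem_nhds hpV), inter_subset_right.trans hVΩ,
    fun z hz => ⟨hc z hz.2, hc0 z hz.2⟩, ?_⟩
  rintro z ⟨hzZ, hzW, -⟩ w ⟨hwZ, hwW, -⟩
  obtain ⟨x, hx, rfl⟩ := hWF ⟨hzW, hzZ⟩
  obtain ⟨y, hy, rfl⟩ := hWF ⟨hwW, hwZ⟩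
  refine gram_eq_of_polarCurvature_eq (V := V) (e := e) (e' := fun x => c x • e' x)
    (he.mono hVΩ) (fun z hz => (hc z hz).smul (he' z (hVΩ hz))) hV Metric.isOpen_ball
    (convex_ball 0 ε) (fun x hx => (hball hx).1.differentiableAt.differentiableWithinAt)
    (fun x hx => (hball hx).2.2) (Metric.mem_ball_self hε) ?_ ?_ ?_ ?_ hx hy
  · exact fun x hx y hy => hne _ (hball hx).2.2 _ (hball hy).2.2
  · intro x hx y hy
    have h1 := hc0 _ (hball hx).2.2
    have h2 := hc0 _ (hball hy).2.2
    have h3 := hne' _ (hball hx).2.2 _ (hball hy).2.2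
    rw [dualInner_smul_left, dualInner_smul_right]
    exact mul_ne_zero h1 (mul_ne_zero (by simpa using h2) h3)
  · intro z hz
    have h3 := hne' _ hz p hpV
    rw [hF0, dualInner_smul_left, dualInner_smul_right, hcp, Complex.conj_ofReal]
    simp only [c]
    field_simp
  · intro x hx v u
    have hxV := (hball hx).2.2
    rw [polarCurvature_smul (hc _ hxV).differentiableAt (he' _ (hVΩ hxV)).differentiableAt
      (hc0 _ hxV) (h0' _ (hVΩ hxV))]
    exact hcurv _ (hball hx).2.1 v u

end LocalGram

/-! ### Unitaries from equal Gram matrices -/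

section Unitary

variable {X X' : Type*} [NormedAddCommGroup X] [InnerProductSpace ℂ X] [CompleteSpace X]
  [NormedAddCommGroup X'] [InnerProductSpace ℂ X'] [CompleteSpace X']

theorem denseRange_linearCombination {ι : Type*} {u : ι → X}
    (hu : ∀ x, (∀ i, inner ℂ (u i) x = 0) → x = 0) :
    DenseRange (Finsupp.linearCombination ℂ u) := by
  have h1 : (Submodule.span ℂ (range u)).topologicalClosure = ⊤ := by
    rw [Submodule.topologicalClosure_eq_top_iff, Submodule.eq_bot_iff]
    intro x hx
    refine hu x fun i => ?_
    exact (Submodule.mem_orthogonal _ x).mp hx (u i) (Submodule.subset_span ⟨i, rfl⟩)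
  rw [DenseRange, ← LinearMap.coe_range, Finsupp.range_linearCombination]
  exact (Submodule.dense_iff_topologicalClosure_eq_top).mpr h1

/-- Families with total span and equal Gram matrices are unitarily equivalent. -/
theorem exists_linearIsometryEquiv_of_inner_eq {ι : Type*} {u : ι → X} {u' : ι → X'}
    (hu : ∀ x, (∀ i, inner ℂ (u i) x = 0) → x = 0)
    (hu' : ∀ x, (∀ i, inner ℂ (u' i) x = 0) → x = 0)
    (h : ∀ i j, inner ℂ (u i) (u j) = inner ℂ (u' i) (u' j)) :
    ∃ T : X ≃ₗᵢ[ℂ] X', ∀ i, T (u i) = u' i := by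
  have hnorm : ∀ x : ι →₀ ℂ, ‖Finsupp.linearCombination ℂ u' (LinearEquiv.refl ℂ (ι →₀ ℂ) x)‖ =
      ‖Finsupp.linearCombination ℂ u x‖ := by
    intro x
    rw [LinearEquiv.refl_apply, norm_eq_sqrt_re_inner (𝕜 := ℂ), norm_eq_sqrt_re_inner (𝕜 := ℂ)]
    simp only [Finsupp.linearCombination_apply, Finsupp.sum, sum_inner, inner_sum,
      inner_smul_left, inner_smul_right, h]
  refine ⟨(LinearEquiv.refl ℂ (ι →₀ ℂ)).extendOfIsometry (Finsupp.linearCombination ℂ u)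
    (Finsupp.linearCombination ℂ u') (denseRange_linearCombination hu)
    (denseRange_linearCombination hu') hnorm, fun i => ?_⟩
  have := LinearEquiv.extendOfIsometry_eq (LinearEquiv.refl ℂ (ι →₀ ℂ))
    (Finsupp.linearCombination ℂ u) (Finsupp.linearCombination ℂ u')
    (denseRange_linearCombination hu) (denseRange_linearCombination hu') hnorm
    (Finsupp.single i 1)
  simpa using this

end Unitary

/-! ### Isomorphic quotients and equality of the full curvature on `Z` -/

namespace QuasiFree

variable {m : ℕ} {Ω Z : Set (EuclideanSpace ℂ (Fin m))}
  {H : Type*} [NormedAddCommGroup H] [InnerProductSpace ℂ H] [CompleteSpace H]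
  {H' : Type*} [NormedAddCommGroup H'] [InnerProductSpace ℂ H'] [CompleteSpace H']

theorem metric_eq (M : QuasiFree Ω H) :
    M.metric = fun w => dualInner (M.eval w) (M.eval w) := by
  ext w
  have h : ContinuousLinearMap.adjoint (M.eval w) 1 =
      (InnerProductSpace.toDual ℂ H).symm (M.eval w) := by
    refine ext_inner_right ℂ fun x => ?_
    rw [ContinuousLinearMap.adjoint_inner_left, InnerProductSpace.toDual_symm_apply]
    simp
  rw [metric, kernel, h, dualInner]

theorem eval_emb_one (M : QuasiFree Ω H) {w : EuclideanSpace ℂ (Fin m)} (hw : w ∈ Ω) :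
    M.eval w (M.emb 1) = 1 := by
  rw [eval_emb M hw, evalA_one (subset_closure hw)]

theorem eval_ne_zero (M : QuasiFree Ω H) {w : EuclideanSpace ℂ (Fin m)} (hw : w ∈ Ω) :
    M.eval w ≠ 0 := by
  intro h
  have := M.eval_emb_one hw
  rw [h] at this
  simp at this

theorem fderiv_eval_apply (M : QuasiFree Ω H) (hΩ : IsOpen Ω) (hΩb : Bornology.IsBounded Ω)
    {w : EuclideanSpace ℂ (Fin m)} (hw : w ∈ Ω) (v : EuclideanSpace ℂ (Fin m)) (x : H) :
    fderiv ℂ (fun w => M.eval w x) w v = fderiv ℂ M.eval w v x := by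
  have := ((ContinuousLinearMap.apply ℂ ℂ x).hasFDerivAt.comp w
    (M.analyticOnNhd_eval hΩ hΩb w hw).differentiableAt.hasFDerivAt).fderiv
  exact DFunLike.congr_fun this v

theorem fderiv_eval_emb (M : QuasiFree Ω H) (hΩ : IsOpen Ω) (hΩb : Bornology.IsBounded Ω)
    {w : EuclideanSpace ℂ (Fin m)} (hw : w ∈ Ω) (v : EuclideanSpace ℂ (Fin m)) (f : AlgA Ω) :
    fderiv ℂ M.eval w v (M.emb f) = fderiv ℂ (fun z => evalA Ω z f) w v := by
  rw [← M.fderiv_eval_apply hΩ hΩb hw]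
  have : (fun z => M.eval z (M.emb f)) =ᶠ[𝓝 w] fun z => evalA Ω z f := by
    filter_upwards [hΩ.mem_nhds hw] with z hz using eval_emb M hz f
  rw [this.fderiv_eq]

/-- The Leibniz rule: under the adjoint action the derivatives of the evaluation at `w` are
generalized eigenvectors over the evaluation itself. -/
theorem fderiv_eval_act (M : QuasiFree Ω H) (hΩ : IsOpen Ω) (hΩb : Bornology.IsBounded Ω)
    {w : EuclideanSpace ℂ (Fin m)} (hw : w ∈ Ω) (v : EuclideanSpace ℂ (Fin m)) (f : AlgA Ω)
    (x : H) : fderiv ℂ M.eval w v (M.act f x) =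
      evalA Ω w f * fderiv ℂ M.eval w v x +
        fderiv ℂ (fun z => evalA Ω z f) w v * M.eval w x := by
  rw [← M.fderiv_eval_apply hΩ hΩb hw]
  have h1 : (fun z => M.eval z (M.act f x)) =ᶠ[𝓝 w] fun z => evalA Ω z f * M.eval z x := by
    filter_upwards [hΩ.mem_nhds hw] with z hz using M.eval_act hz f x
  rw [h1.fderiv_eq, fderiv_fun_mul (analyticOnNhd_evalA hΩ hΩb f w hw).differentiableAt
    (M.analyticOnNhd_eval_apply hΩ hΩb x w hw).differentiableAt, ← M.fderiv_eval_apply hΩ hΩb hw]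
  simp [mul_comm]

theorem riesz_eval_mem_quot (M : QuasiFree Ω H) (hΩ : IsOpen Ω) (hΩb : Bornology.IsBounded Ω)
    (hZ : IsHypersurface Ω Z) {p : EuclideanSpace ℂ (Fin m)} (hp : p ∈ Z) :
    (InnerProductSpace.toDual ℂ H).symm (M.eval p) ∈ M.quot Z := by
  rw [Submodule.mem_orthogonal']
  intro x hx
  rw [InnerProductSpace.toDual_symm_apply]
  exact ((M.mem_vanishing_two_iff hΩ hΩb hZ).mp hx p hp).1

theorem riesz_fderiv_eval_mem_quot (M : QuasiFree Ω H) (hΩ : IsOpen Ω)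
    (hΩb : Bornology.IsBounded Ω) (hZ : IsHypersurface Ω Z) {p : EuclideanSpace ℂ (Fin m)}
    (hp : p ∈ Z) (v : EuclideanSpace ℂ (Fin m)) :
    (InnerProductSpace.toDual ℂ H).symm (fderiv ℂ M.eval p v) ∈ M.quot Z := by
  rw [Submodule.mem_orthogonal']
  intro x hx
  rw [InnerProductSpace.toDual_symm_apply]
  exact ((M.mem_vanishing_two_iff hΩ hΩb hZ).mp hx p hp).2 v

theorem inner_quotAct (M : QuasiFree Ω H) (f : AlgA Ω) (y x : M.quot Z) :
    inner ℂ y (M.quotAct Z f x) = inner ℂ (y : H) (M.act f x) := by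
  rw [quotAct, ContinuousLinearMap.comp_apply, ContinuousLinearMap.comp_apply]
  exact Submodule.inner_orthogonalProjectionOnto_eq_of_mem_left y _

theorem act_mem_vanishing (M : QuasiFree Ω H) (hΩ : IsOpen Ω) (hΩb : Bornology.IsBounded Ω)
    (hZ : IsHypersurface Ω Z) (f : AlgA Ω) {x : H} (hx : x ∈ M.vanishing Z 2) :
    M.act f x ∈ M.vanishing Z 2 := by
  rw [M.mem_vanishing_two_iff hΩ hΩb hZ] at hx ⊢
  intro p hp
  refine ⟨by rw [M.eval_act (hZ.1 hp), (hx p hp).1, mul_zero], fun v => ?_⟩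
  rw [M.fderiv_eval_act hΩ hΩb (hZ.1 hp), (hx p hp).1, (hx p hp).2 v, mul_zero, mul_zero, add_zero]

/-- On the orthogonal complement of an invariant subspace, relations for the compressed action are
relations for the action. -/
theorem inner_act_eq_of_quotAct (M : QuasiFree Ω H) (hΩ : IsOpen Ω) (hΩb : Bornology.IsBounded Ω)
    (hZ : IsHypersurface Ω Z) (f : AlgA Ω) {y a : M.quot Z}
    (h : ∀ x : M.quot Z, inner ℂ y (M.quotAct Z f x) = inner ℂ a x) (x : H) :
    inner ℂ (y : H) (M.act f x) = inner ℂ (a : H) x := by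
  have hinv : ∀ y : M.quot Z, ∀ w ∈ (M.quot Z)ᗮ, inner ℂ (y : H) w = 0 := fun y w hw =>
    (Submodule.mem_orthogonal _ w).mp hw y y.2
  set q := (M.quot Z).orthogonalProjectionOnto x
  have hw : x - q ∈ (M.quot Z)ᗮ := (M.quot Z).sub_starProjection_mem_orthogonal x
  have hact : M.act f (x - q) ∈ (M.quot Z)ᗮ := by
    -- The double orthogonal complement is the closure of the submodule, which inherits invariance
    -- by continuity of the action.
    have h2 : x - q ∈ (M.vanishing Z 2).topologicalClosure := by
      rwa [← Submodule.orthogonal_orthogonal_eq_closure]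
    have h3 : M.act f (x - q) ∈ (M.vanishing Z 2).topologicalClosure := by
      refine map_mem_closure (M.act f).continuous h2 fun z hz => ?_
      exact M.act_mem_vanishing hΩ hΩb hZ f hz
    rwa [← Submodule.orthogonal_orthogonal_eq_closure] at h3
  have hx : x = q + (x - q) := by abel
  rw [hx, map_add, inner_add_right, inner_add_right, hinv y _ hact, hinv a _ hw, add_zero,
    add_zero, ← M.inner_quotAct f y q, h q]
  rfl

theorem functional_ext (M : QuasiFree Ω H) {a b : StrongDual ℂ H}
    (h : ∀ f, a (M.emb f) = b (M.emb f)) : a = b := by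
  ext x
  exact M.emb_dense.induction_on x (isClosed_eq (by fun_prop) (by fun_prop)) h

/-- The eigenvector relations of the Riesz vectors are stated through the action alone, so `T`
preserves them; the gauge identity then compares the Gram matrices on the two sides. -/
theorem polarCurvature_eq_of_quotIso (M : QuasiFree Ω H) (M' : QuasiFree Ω H') (hΩ : IsOpen Ω)
    (hΩb : Bornology.IsBounded Ω) (hZ : IsHypersurface Ω Z) (hiso : M.QuotIso M' Z)
    {p : EuclideanSpace ℂ (Fin m)} (hp : p ∈ Z) (v u : EuclideanSpace ℂ (Fin m)) :
    polarCurvature M.eval p p v u = polarCurvature M'.eval p p v u := by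
  obtain ⟨T, hT⟩ := hiso
  have hpΩ := hZ.1 hp
  let k : M.quot Z := ⟨_, M.riesz_eval_mem_quot hΩ hΩb hZ hp⟩
  let d : EuclideanSpace ℂ (Fin m) → M.quot Z := fun v =>
    ⟨_, M.riesz_fderiv_eval_mem_quot hΩ hΩb hZ hp v⟩
  have hk : ∀ x : M.quot Z, inner ℂ k x = M.eval p x := fun x =>
    InnerProductSpace.toDual_symm_apply
  have hd : ∀ v, ∀ x : M.quot Z, inner ℂ (d v) x = fderiv ℂ M.eval p v x := fun v x =>
    InnerProductSpace.toDual_symm_apply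
  have hkact : ∀ f, ∀ x : M'.quot Z, inner ℂ (T k) (M'.quotAct Z f x) =
      inner ℂ ((starRingEnd ℂ) (evalA Ω p f) • T k) x := by
    intro f x
    obtain ⟨x, rfl⟩ := T.surjective x
    rw [← hT, inner_smul_left, T.inner_map_map, T.inner_map_map, M.inner_quotAct, hk]
    change inner ℂ ((InnerProductSpace.toDual ℂ H).symm (M.eval p)) _ = _
    rw [InnerProductSpace.toDual_symm_apply, M.eval_act hpΩ]
    simp
  have hdact : ∀ v f, ∀ x : M'.quot Z, inner ℂ (T (d v)) (M'.quotAct Z f x) =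
      inner ℂ ((starRingEnd ℂ) (evalA Ω p f) • T (d v) +
        (starRingEnd ℂ) (fderiv ℂ (fun z => evalA Ω z f) p v) • T k) x := by
    intro v f x
    obtain ⟨x, rfl⟩ := T.surjective x
    rw [← hT, inner_add_left, inner_smul_left, inner_smul_left, T.inner_map_map, T.inner_map_map,
      T.inner_map_map, M.inner_quotAct, hk, hd]
    change inner ℂ ((InnerProductSpace.toDual ℂ H).symm (fderiv ℂ M.eval p v)) _ = _
    rw [InnerProductSpace.toDual_symm_apply, M.fderiv_eval_act hΩ hΩb hpΩ]
    simp
  let R := InnerProductSpace.toDual ℂ H'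
  -- Applying the transported relations to `f = f · 1` expresses the functionals through their
  -- values at `1`; these are the coefficients `s` and `t v`.
  set s : ℂ := inner ℂ (T k : H') (M'.emb 1)
  set t : EuclideanSpace ℂ (Fin m) → ℂ := fun v => inner ℂ (T (d v) : H') (M'.emb 1)
  have hTk : R (T k) = s • M'.eval p := by
    refine M'.functional_ext fun f => ?_
    have h1 := M'.inner_act_eq_of_quotAct hΩ hΩb hZ f (hkact f) (M'.emb 1)
    rw [M'.act_emb, mul_one, Submodule.coe_smul, inner_smul_left, Complex.conj_conj] at h1
    rw [InnerProductSpace.toDual_apply_apply, h1, _root_.smul_apply, smul_eq_mul,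
      eval_emb M' hpΩ, mul_comm]
  have hTd : ∀ v, R (T (d v)) = s • fderiv ℂ M'.eval p v + t v • M'.eval p := by
    intro v
    refine M'.functional_ext fun f => ?_
    have h1 := M'.inner_act_eq_of_quotAct hΩ hΩb hZ f (hdact v f) (M'.emb 1)
    rw [M'.act_emb, mul_one, Submodule.coe_add, Submodule.coe_smul, Submodule.coe_smul,
      inner_add_left, inner_smul_left, inner_smul_left, Complex.conj_conj, Complex.conj_conj] at h1
    rw [InnerProductSpace.toDual_apply_apply, h1, _root_.add_apply, _root_.smul_apply,
      _root_.smul_apply, smul_eq_mul, smul_eq_mul, eval_emb M' hpΩ,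
      M'.fderiv_eval_emb hΩ hΩb hpΩ]
    ring
  have htr : ∀ x y : M.quot Z, dualInner (InnerProductSpace.toDual ℂ H x)
      (InnerProductSpace.toDual ℂ H y) = dualInner (R (T x)) (R (T y)) := by
    intro x y
    rw [dualInner_eq_inner, dualInner_eq_inner]
    simp only [R, LinearIsometryEquiv.symm_apply_apply]
    exact (T.inner_map_map x y).symm
  have hek : M.eval p = InnerProductSpace.toDual ℂ H k := by
    simp [k]
  have hed : ∀ v, fderiv ℂ M.eval p v = InnerProductSpace.toDual ℂ H (d v) := by
    intro v; simp [d]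
  have hs : s ≠ 0 := by
    intro h0
    have hz : R (T k) = 0 := by
      rw [hTk, h0]
      ext x
      simp
    have h1 : T k = 0 := by simpa [R] using hz
    have h2 : k = 0 := by simpa using h1
    rw [h2] at hek
    exact M.eval_ne_zero hpΩ (by simpa using hek)
  have hs' : (starRingEnd ℂ) s ≠ 0 := by simpa using hs
  rw [polarCurvature, polarCurvature, ← curvature_gauge (t := t v) (t' := (starRingEnd ℂ) (t u))
    hs hs' (dualInner_self_ne_zero (M'.eval_ne_zero hpΩ)), hek, hed, hed, htr, htr, htr, htr,
    hTk, hTd, hTd]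
  simp only [dualInner_add_left, dualInner_add_right, dualInner_smul_left, dualInner_smul_right]
  ring

/-- Elements of the quotient module are determined by their first order jets on an open part of
`Z`. -/
theorem eq_zero_of_mem_quot (M : QuasiFree Ω H) (hΩ : IsOpen Ω) (hΩb : Bornology.IsBounded Ω)
    (hZ : IsHypersurface Ω Z) (hZc : IsPreconnected Z) {p : EuclideanSpace ℂ (Fin m)} (hp : p ∈ Z)
    {W : Set (EuclideanSpace ℂ (Fin m))} (hW : W ∈ 𝓝 p) {x : H} (hx : x ∈ M.quot Z)
    (h : ∀ z ∈ Z ∩ W, M.eval z x = 0 ∧ ∀ v, fderiv ℂ M.eval z v x = 0) : x = 0 := by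
  have he := M.analyticOnNhd_eval hΩ hΩb
  have hev : ∀ᶠ z in 𝓝[Z] p, z ∈ Z ∩ W :=
    inter_mem self_mem_nhdsWithin (mem_nhdsWithin_of_mem_nhds hW)
  -- The identity theorem on `Z`, for the function and for its full differential, extends the
  -- vanishing from `Z ∩ W` to `Z`. Then `x` lies both in the submodule and in its orthogonal
  -- complement.
  have h1 := hZ.eqOn_zero hZc (M.analyticOnNhd_eval_apply hΩ hΩb x) hp
    (hev.mono fun z hz => (h z hz).1)
  have h2 := hZ.eqOn_zero hZc (f := fderiv ℂ fun w => M.eval w x)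
    (M.analyticOnNhd_eval_apply hΩ hΩb x).fderiv hp (hev.mono fun z hz => by
      ext v
      rw [M.fderiv_eval_apply hΩ hΩb (hZ.1 hz.1)]
      exact (h z hz).2 v)
  have hv : x ∈ M.vanishing Z 2 := by
    rw [M.mem_vanishing_two_iff hΩ hΩb hZ]
    refine fun z hz => ⟨h1 z hz, fun v => ?_⟩
    rw [← M.fderiv_eval_apply hΩ hΩb (hZ.1 hz), h2 z hz]
    rfl
  exact inner_self_eq_zero.mp ((Submodule.mem_orthogonal _ x).mp hx x hv)

theorem quotIso_of_polarCurvature_eq (M : QuasiFree Ω H) (M' : QuasiFree Ω H') (hΩ : IsOpen Ω)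
    (hΩb : Bornology.IsBounded Ω) (hZ : IsHypersurface Ω Z) (hZc : IsConnected Z)
    (hcurv : ∀ p ∈ Z, ∀ v u, polarCurvature M.eval p p v u = polarCurvature M'.eval p p v u) :
    M.QuotIso M' Z := by
  obtain ⟨p, hp⟩ := hZc.nonempty
  obtain ⟨c, W, hW, hWΩ, hc, hgram⟩ := hZ.exists_gram_eq hΩ (M.analyticOnNhd_eval hΩ hΩb)
    (M'.analyticOnNhd_eval hΩ hΩb) (fun z => M.eval_ne_zero) (fun z => M'.eval_ne_zero) hp hcurv
  set e' : EuclideanSpace ℂ (Fin m) → StrongDual ℂ H' := fun z => c z • M'.eval z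
  have he' : ∀ z ∈ W, ∀ v x, fderiv ℂ e' z v x =
      c z * fderiv ℂ M'.eval z v x + fderiv ℂ c z v * M'.eval z x := by
    intro z hz v x
    rw [fderiv_fun_smul_apply (hc z hz).1.differentiableAt
      (M'.analyticOnNhd_eval hΩ hΩb z (hWΩ hz)).differentiableAt]
    simp
  -- The index `none` stands for the value at the point, `some v` for the derivative along `v`.
  let a : ↥(Z ∩ W) × Option (EuclideanSpace ℂ (Fin m)) → StrongDual ℂ H := fun i =>
    i.2.elim (M.eval i.1) fun v => fderiv ℂ M.eval i.1 v
  let a' : ↥(Z ∩ W) × Option (EuclideanSpace ℂ (Fin m)) → StrongDual ℂ H' := fun i =>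
    i.2.elim (e' i.1) fun v => fderiv ℂ e' i.1 v
  have haa' : ∀ i j, dualInner (a i) (a j) = dualInner (a' i) (a' j) := by
    rintro ⟨z, _ | v⟩ ⟨w, _ | u⟩
    · exact (hgram z z.2 w w.2).1
    · have := (hgram w w.2 z z.2).2.1 u
      change dualInner (M.eval z) (fderiv ℂ M.eval w u) = dualInner (e' z) (fderiv ℂ e' w u)
      rw [← dualInner_conj, this, dualInner_conj]
    · exact (hgram z z.2 w w.2).2.1 v
    · exact (hgram z z.2 w w.2).2.2 v u
  have ha0 : ∀ i, ∀ x ∈ M.vanishing Z 2, a i x = 0 := by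
    rintro ⟨z, _ | v⟩ x hx
    · exact ((M.mem_vanishing_two_iff hΩ hΩb hZ).mp hx z z.2.1).1
    · exact ((M.mem_vanishing_two_iff hΩ hΩb hZ).mp hx z z.2.1).2 v
  have ha0' : ∀ i, ∀ x ∈ M'.vanishing Z 2, a' i x = 0 := by
    rintro ⟨z, _ | v⟩ x hx
    · change c z * M'.eval z x = 0
      rw [((M'.mem_vanishing_two_iff hΩ hΩb hZ).mp hx z z.2.1).1, mul_zero]
    · change fderiv ℂ e' z v x = 0
      rw [he' z z.2.2, ((M'.mem_vanishing_two_iff hΩ hΩb hZ).mp hx z z.2.1).1,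
        ((M'.mem_vanishing_two_iff hΩ hΩb hZ).mp hx z z.2.1).2 v, mul_zero, mul_zero, add_zero]
  have hmem : ∀ i, (InnerProductSpace.toDual ℂ H).symm (a i) ∈ M.quot Z := fun i =>
    (Submodule.mem_orthogonal' _ _).mpr fun x hx => by
      rw [InnerProductSpace.toDual_symm_apply]; exact ha0 i x hx
  have hmem' : ∀ i, (InnerProductSpace.toDual ℂ H').symm (a' i) ∈ M'.quot Z := fun i =>
    (Submodule.mem_orthogonal' _ _).mpr fun x hx => by
      rw [InnerProductSpace.toDual_symm_apply]; exact ha0' i x hx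
  let b : ↥(Z ∩ W) × Option (EuclideanSpace ℂ (Fin m)) → M.quot Z := fun i => ⟨_, hmem i⟩
  let b' : ↥(Z ∩ W) × Option (EuclideanSpace ℂ (Fin m)) → M'.quot Z := fun i => ⟨_, hmem' i⟩
  have hb : ∀ i (x : M.quot Z), inner ℂ (b i) x = a i x := fun i x =>
    InnerProductSpace.toDual_symm_apply
  have hb' : ∀ i (x : M'.quot Z), inner ℂ (b' i) x = a' i x := fun i x =>
    InnerProductSpace.toDual_symm_apply
  have htot : ∀ x, (∀ i, inner ℂ (b i) x = 0) → x = 0 := by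
    intro x hx
    simp only [hb] at hx
    refine Subtype.ext (M.eq_zero_of_mem_quot hΩ hΩb hZ hZc.isPreconnected hp hW x.2 ?_)
    exact fun z hz => ⟨hx ⟨⟨z, hz⟩, none⟩, fun v => hx ⟨⟨z, hz⟩, some v⟩⟩
  have htot' : ∀ x, (∀ i, inner ℂ (b' i) x = 0) → x = 0 := by
    intro x hx
    simp only [hb'] at hx
    refine Subtype.ext (M'.eq_zero_of_mem_quot hΩ hΩb hZ hZc.isPreconnected hp hW x.2 ?_)
    intro z hz
    have h1 : M'.eval z x = 0 := by
      have h2 : c z * M'.eval z x = 0 := hx ⟨⟨z, hz⟩, none⟩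
      exact (mul_eq_zero.mp h2).resolve_left (hc z hz.2).2
    refine ⟨h1, fun v => ?_⟩
    have h2 : fderiv ℂ e' z v x = 0 := hx ⟨⟨z, hz⟩, some v⟩
    rw [he' z hz.2, h1, mul_zero, add_zero] at h2
    exact (mul_eq_zero.mp h2).resolve_left (hc z hz.2).2
  obtain ⟨T, hT⟩ := exists_linearIsometryEquiv_of_inner_eq htot htot' fun i j => by
    have := haa' i j
    rwa [dualInner_eq_inner, dualInner_eq_inner] at this
  have hTa : ∀ i (x : M.quot Z), a' i (T x) = a i x := by
    intro i x
    rw [← hb', ← hT, T.inner_map_map, hb]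
  refine ⟨T, fun f x => ?_⟩
  rw [← sub_eq_zero]
  -- The intertwining relation is tested against the total family, where it reduces to the Leibniz
  -- rule on both sides; the terms with the derivative of `c` match.
  refine htot' _ fun i => ?_
  rw [inner_sub_right, sub_eq_zero, M'.inner_quotAct, ← hT, T.inner_map_map, M.inner_quotAct, hT]
  change inner ℂ ((InnerProductSpace.toDual ℂ H).symm (a i)) _ =
    inner ℂ ((InnerProductSpace.toDual ℂ H').symm (a' i)) _
  rw [InnerProductSpace.toDual_symm_apply, InnerProductSpace.toDual_symm_apply]
  obtain ⟨z, _ | v⟩ := i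
  · have h1 : c z * M'.eval z (T x) = M.eval z x := hTa ⟨z, none⟩ x
    change M.eval z (M.act f x) = c z * M'.eval z (M'.act f (T x))
    rw [M.eval_act (hZ.1 z.2.1), M'.eval_act (hZ.1 z.2.1), ← h1]
    ring
  · have h1 : c z * M'.eval z (T x) = M.eval z x := hTa ⟨z, none⟩ x
    have h2 : fderiv ℂ e' z v (T x) = fderiv ℂ M.eval z v x := hTa ⟨z, some v⟩ x
    change fderiv ℂ M.eval z v (M.act f x) = fderiv ℂ e' z v (M'.act f (T x))
    rw [he' z z.2.2] at h2 ⊢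
    rw [M.fderiv_eval_act hΩ hΩb (hZ.1 z.2.1), M'.fderiv_eval_act hΩ hΩb (hZ.1 z.2.1),
      M'.eval_act (hZ.1 z.2.1), ← h1, ← h2]
    ring

end QuasiFree

/-! ### The Gram–Schmidt frame of the jet bundle -/

section GramSchmidt

theorem fiberInner_smul_fst (N : Matrix (Fin 2) (Fin 2) ℂ) (a : Fin 2 → ℂ) (r : ℂ) :
    fiberInner N a (r • ![1, 0]) = (starRingEnd ℂ) r * N.mulVec a 0 := by
  simp [fiberInner, dotProduct, Fin.sum_univ_two]

theorem fiberInner_apply (N : Matrix (Fin 2) (Fin 2) ℂ) (a b : Fin 2 → ℂ) :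
    fiberInner N a b = (starRingEnd ℂ) (b 0) * (N 0 0 * a 0 + N 0 1 * a 1) +
      (starRingEnd ℂ) (b 1) * (N 1 0 * a 0 + N 1 1 * a 1) := by
  simp [fiberInner, dotProduct, Fin.sum_univ_two, Matrix.mulVec]

theorem gramSchmidt₁_eq (N : Matrix (Fin 2) (Fin 2) ℂ) :
    gramSchmidt₁ N = ((Real.sqrt (N 0 0).re)⁻¹ : ℂ) • ![1, 0] := by
  simp [gramSchmidt₁, fiberNorm, fiberInner_apply]

theorem gramSchmidt₂_eq {N : Matrix (Fin 2) (Fin 2) ℂ} {a : ℝ} (ha : 0 < a)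
    (h00 : N 0 0 = a) :
    gramSchmidt₂ N = ((Real.sqrt (N 1 1 - N 0 1 * N 1 0 / N 0 0).re)⁻¹ : ℂ) •
      ![-(N 0 1 / N 0 0), 1] := by
  have hs : ((Real.sqrt a : ℝ) : ℂ) ≠ 0 := by
    exact_mod_cast (Real.sqrt_pos.mpr ha).ne'
  have hss : ((Real.sqrt a : ℝ) : ℂ) * (Real.sqrt a : ℝ) = a := by
    exact_mod_cast Real.mul_self_sqrt ha.le
  have ha' : (a : ℂ) ≠ 0 := by exact_mod_cast ha.ne'
  have hx : (![0, 1] - fiberInner N ![0, 1] (gramSchmidt₁ N) • gramSchmidt₁ N : Fin 2 → ℂ) =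
      ![-(N 0 1 / N 0 0), 1] := by
    rw [gramSchmidt₁_eq, fiberInner_smul_fst, h00]
    ext i
    fin_cases i
    · simp [Matrix.mulVec, dotProduct, Fin.sum_univ_two]
      rw [← hss]
      field_simp
    · simp
  have hn : fiberInner N ![-(N 0 1 / N 0 0), 1] ![-(N 0 1 / N 0 0), 1] =
      N 1 1 - N 0 1 * N 1 0 / N 0 0 := by
    rw [fiberInner_apply, h00]
    simp
    field_simp
    ring
  rw [gramSchmidt₂]
  simp only [hx]
  rw [fiberNorm, hn]

end GramSchmidt

/-! ### The second fundamental form in terms of the curvature -/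

section SecondFundamentalForm

variable {m : ℕ}

theorem dHol_apply {E : Type*} [NormedAddCommGroup E] [NormedSpace ℂ E] {n : ℕ}
    {σ : E → Fin n → ℂ} {z : E} (hσ : DifferentiableAt ℝ σ z) (v : E) (i : Fin n) :
    dHol σ z v i = dHol (fun w => σ w i) z v := by
  have h : fderiv ℝ (fun w => σ w i) z = (ContinuousLinearMap.proj i).comp (fderiv ℝ σ z) :=
    ((ContinuousLinearMap.proj (R := ℝ) (φ := fun _ : Fin n => ℂ) i).hasFDerivAt.comp z
      hσ.hasFDerivAt).fderiv
  simp [dHol, h]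

theorem dBar_apply {E : Type*} [NormedAddCommGroup E] [NormedSpace ℂ E] {n : ℕ}
    {σ : E → Fin n → ℂ} {z : E} (hσ : DifferentiableAt ℝ σ z) (v : E) (i : Fin n) :
    dBar σ z v i = dBar (fun w => σ w i) z v := by
  have h : fderiv ℝ (fun w => σ w i) z = (ContinuousLinearMap.proj i).comp (fderiv ℝ σ z) :=
    ((ContinuousLinearMap.proj (R := ℝ) (φ := fun _ : Fin n => ℂ) i).hasFDerivAt.comp z
      hσ.hasFDerivAt).fderiv
  simp [dBar, h]

/-- The component of `D σ` along the first frame vector, for a section `σ` orthogonal to it. -/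
theorem mulVec_chernD_of_orthogonal {N : EuclideanSpace ℂ (Fin m) → Matrix (Fin 2) (Fin 2) ℂ}
    {σ : EuclideanSpace ℂ (Fin m) → Fin 2 → ℂ} {z : EuclideanSpace ℂ (Fin m)}
    (hN : ∀ j, DifferentiableAt ℝ (fun w => N w 0 j) z) (hσ : DifferentiableAt ℝ σ z)
    (hdet : IsUnit (N z).det) (h0 : ∀ᶠ w in 𝓝 z, N w 0 0 * σ w 0 + N w 0 1 * σ w 1 = 0)
    (v : EuclideanSpace ℂ (Fin m)) :
    (N z).mulVec (chernD N σ z v) 0 =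
      -(dBar (fun w => N w 0 0) z v * σ z 0 + dBar (fun w => N w 0 1) z v * σ z 1) := by
  have hσi : ∀ i, DifferentiableAt ℝ (fun w => σ w i) z := fun i => (differentiableAt_pi.mp hσ) i
  -- Differentiate the orthogonality relation. In the connection `N` cancels `N⁻¹`, so `⟨Dσ, s⟩`
  -- contains every term of this derivative except those where `∂̄` falls on `N`.
  have h1 : fderiv ℝ (fun w => N w 0 0 * σ w 0 + N w 0 1 * σ w 1) z = 0 := by
    have : (fun w => N w 0 0 * σ w 0 + N w 0 1 * σ w 1) =ᶠ[𝓝 z] fun _ => (0 : ℂ) := h0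
    rw [this.fderiv_eq]
    simp
  have h2 : ∀ u, N z 0 0 * fderiv ℝ (fun w => σ w 0) z u + σ z 0 * fderiv ℝ (fun w => N w 0 0) z u
      + (N z 0 1 * fderiv ℝ (fun w => σ w 1) z u +
        σ z 1 * fderiv ℝ (fun w => N w 0 1) z u) = 0 := by
    intro u
    rw [fderiv_fun_add ((hN 0).fun_mul (hσi 0)) ((hN 1).fun_mul (hσi 1)),
      fderiv_fun_mul (hN 0) (hσi 0),
      fderiv_fun_mul (hN 1) (hσi 1)] at h1
    simpa using DFunLike.congr_fun h1 u
  have h3 : (N z).mulVec (((N z)⁻¹ * Matrix.of fun i j => dHol (fun w => N w i j) z v).mulVec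
      (σ z)) 0 = dHol (fun w => N w 0 0) z v * σ z 0 + dHol (fun w => N w 0 1) z v * σ z 1 := by
    rw [Matrix.mulVec_mulVec, ← Matrix.mul_assoc, Matrix.mul_nonsing_inv _ hdet, Matrix.one_mul]
    simp [Matrix.mulVec, dotProduct, Fin.sum_univ_two]
  rw [chernD, Matrix.mulVec_add, Matrix.mulVec_add, Pi.add_apply, Pi.add_apply, h3]
  simp only [Matrix.mulVec, dotProduct, Fin.sum_univ_two, dHol_apply hσ, dBar_apply hσ]
  simp only [dHol, dBar, smul_eq_mul]
  have h4 := h2 v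
  linear_combination h4

theorem AnalyticAt.clm_apply_field {E F G : Type*} [NormedAddCommGroup E] [NormedSpace ℂ E]
    [NormedAddCommGroup F] [NormedSpace ℂ F] [NormedAddCommGroup G] [NormedSpace ℂ G]
    {f : E → F →L[ℂ] G} {g : E → F} {x : E} (hf : AnalyticAt ℂ f x) (hg : AnalyticAt ℂ g x) :
    AnalyticAt ℂ (fun w => f w (g w)) x :=
  ((ContinuousLinearMap.id ℂ (F →L[ℂ] G)).analyticAt_bilinear (f x, g x)).comp
    (f := fun w => (f w, g w)) (hf.prod hg)

variable {X : Type*} [NormedAddCommGroup X] [InnerProductSpace ℂ X] [CompleteSpace X]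
  {e : EuclideanSpace ℂ (Fin m) → StrongDual ℂ X}
  {ν : EuclideanSpace ℂ (Fin m) → EuclideanSpace ℂ (Fin m)} {p : EuclideanSpace ℂ (Fin m)}

theorem jetMetric_eq_gram (he : AnalyticAt ℂ e p) (hν : AnalyticAt ℂ ν p) :
    jetMetric ν (fun w => dualInner (e w) (e w)) p =
      !![dualInner (e p) (e p), dualInner (fderiv ℂ e p (ν p)) (e p);
        dualInner (e p) (fderiv ℂ e p (ν p)),
        dualInner (fderiv ℂ e p (ν p)) (fderiv ℂ e p (ν p))] := by
  have h1 : (fun w => dHol (fun w => dualInner (e w) (e w)) w (ν w)) =ᶠ[𝓝 p]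
      fun w => dualInner (fderiv ℂ e w (ν w)) (e w) := by
    filter_upwards [he.eventually_analyticAt] with w hw
    rw [dHol_dualInner hw.differentiableAt hw.differentiableAt]
  have hA := he.fderiv.clm_apply_field hν
  rw [jetMetric, dHol_dualInner he.differentiableAt he.differentiableAt,
    dBar_dualInner he.differentiableAt he.differentiableAt, h1.dBar_eq,
    dBar_dualInner (a := fun w => fderiv ℂ e w (ν w)) hA.differentiableAt he.differentiableAt]

/-- The left side is the squared length of the part of `a` orthogonal to `b`; in particular it is
real and nonnegative. -/
theorem dualInner_sub_proj (a b : StrongDual ℂ X) (hb : b ≠ 0) :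
    dualInner a a - dualInner a b * dualInner b a / dualInner b b =
      ((‖a - (dualInner a b / dualInner b b) • b‖ ^ 2 : ℝ) : ℂ) := by
  have h0 := dualInner_self_ne_zero hb
  have hsub : a - (dualInner a b / dualInner b b) • b =
      a + (-(dualInner a b / dualInner b b)) • b := by
    ext x
    simp [sub_eq_add_neg]
  rw [← dualInner_self, hsub]
  simp only [dualInner_add_left, dualInner_add_right, dualInner_smul_left, dualInner_smul_right,
    map_neg, map_div₀, dualInner_conj]
  field_simp
  ring

/-- Hence the curvature is nonnegative, and it is zero in the direction `v` only if `∂_v e` is a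
multiple of `e` at `p`. -/
theorem polarCurvature_self_eq (he0 : e p ≠ 0) (v : EuclideanSpace ℂ (Fin m)) :
    polarCurvature e p p v v =
      ((‖fderiv ℂ e p v - (dualInner (fderiv ℂ e p v) (e p) / dualInner (e p) (e p)) • e p‖ ^ 2 /
        ‖e p‖ ^ 2 : ℝ) : ℂ) := by
  have h0 := dualInner_self_ne_zero he0
  have h1 := dualInner_sub_proj (fderiv ℂ e p v) (e p) he0
  rw [Complex.ofReal_div, ← h1, ← dualInner_self, polarCurvature]
  field_simp

/-- The second fundamental form in terms of the curvature. -/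
theorem secondFundamentalForm_eq (he : AnalyticAt ℂ e p) (hν : AnalyticAt ℂ ν p) (he0 : e p ≠ 0)
    (hpos : polarCurvature e p p (ν p) (ν p) ≠ 0) (v : EuclideanSpace ℂ (Fin m)) :
    secondFundamentalForm ν (fun w => dualInner (e w) (e w)) p v =
      -((Real.sqrt (polarCurvature e p p (ν p) (ν p)).re : ℝ) : ℂ)⁻¹ *
        polarCurvature e p p (ν p) v := by
  set h : EuclideanSpace ℂ (Fin m) → ℂ := fun w => dualInner (e w) (e w)
  let A : EuclideanSpace ℂ (Fin m) → StrongDual ℂ X := fun w => fderiv ℂ e w (ν w)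
  have hA : AnalyticAt ℂ A p := he.fderiv.clm_apply_field hν
  let N : EuclideanSpace ℂ (Fin m) → Matrix (Fin 2) (Fin 2) ℂ := fun w =>
    !![dualInner (e w) (e w), dualInner (A w) (e w); dualInner (e w) (A w), dualInner (A w) (A w)]
  have hN : ∀ᶠ w in 𝓝 p, jetMetric ν h w = N w := by
    filter_upwards [he.eventually_analyticAt, hν.eventually_analyticAt] with w h1 h2
    exact jetMetric_eq_gram h1 h2
  have hedd := he.differentiableAt
  have hAdd := hA.differentiableAt
  have hd00 := differentiableAt_real_dualInner hedd hedd
  have hd01 := differentiableAt_real_dualInner hAdd hedd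
  have hd10 := differentiableAt_real_dualInner hedd hAdd
  have hd11 := differentiableAt_real_dualInner hAdd hAdd
  have h00 : dualInner (e p) (e p) ≠ 0 := dualInner_self_ne_zero he0
  set q : EuclideanSpace ℂ (Fin m) → ℂ := fun w => dualInner (A w) (e w) / dualInner (e w) (e w)
  set g : EuclideanSpace ℂ (Fin m) → ℂ := fun w => dualInner (A w) (A w) -
    dualInner (A w) (e w) * dualInner (e w) (A w) / dualInner (e w) (e w)
  have hdinv : DifferentiableAt ℝ (fun w => (dualInner (e w) (e w))⁻¹) p :=
    (hasFDerivAt_inv_of_ne_zero hd00.hasFDerivAt h00).differentiableAt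
  have hq : DifferentiableAt ℝ q p := by
    simp only [q, div_eq_mul_inv]
    exact hd01.mul hdinv
  have hg : DifferentiableAt ℝ g p := by
    simp only [g, div_eq_mul_inv]
    exact hd11.sub ((hd01.mul hd10).mul hdinv)
  -- `g` is the squared length of the part of `∂_ν s` orthogonal to `s`, and so normalizes `e₂`; at
  -- `p` it is `h` times the transverse curvature. Its positivity makes the square root
  -- differentiable.
  have hgp : g p = dualInner (e p) (e p) * polarCurvature e p p (ν p) (ν p) := by
    simp only [g, polarCurvature, A]
    field_simp
  have hgre : g p = ((g p).re : ℂ) := by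
    simp only [g, dualInner_sub_proj _ _ he0, Complex.ofReal_re]
  have hgpos : 0 < (g p).re := by
    have h1 : 0 ≤ (g p).re := by
      simp only [g, dualInner_sub_proj _ _ he0, Complex.ofReal_re]
      positivity
    refine lt_of_le_of_ne h1 fun h2 => ?_
    rw [← h2, hgp] at hgre
    simp only [Complex.ofReal_zero] at hgre
    exact (mul_ne_zero h00 hpos) hgre
  let σ : EuclideanSpace ℂ (Fin m) → Fin 2 → ℂ := fun w =>
    (((Real.sqrt (g w).re : ℝ) : ℂ)⁻¹) • ![-q w, 1]
  have hσ : DifferentiableAt ℝ σ p := by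
    have h1 : DifferentiableAt ℝ (fun w => (g w).re) p :=
      Complex.reCLM.differentiableAt.comp p hg
    have h2 : DifferentiableAt ℝ (fun w => ((Real.sqrt (g w).re : ℝ) : ℂ)) p :=
      Complex.ofRealCLM.differentiableAt.comp p (h1.sqrt hgpos.ne')
    have h3 : ((Real.sqrt (g p).re : ℝ) : ℂ) ≠ 0 := by
      exact_mod_cast (Real.sqrt_pos.mpr hgpos).ne'
    have h4 : DifferentiableAt ℝ (fun w => (((Real.sqrt (g w).re : ℝ) : ℂ)⁻¹)) p :=
      (hasFDerivAt_inv_of_ne_zero h2.hasFDerivAt h3).differentiableAt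
    refine differentiableAt_pi.mpr fun i => ?_
    fin_cases i
    · simpa [σ] using (h4.fun_mul hq).neg
    · simpa [σ] using h4
  have hgs : ∀ᶠ w in 𝓝 p, gramSchmidt₂ (jetMetric ν h w) = σ w := by
    filter_upwards [hN, he.continuousAt.eventually_ne he0] with w h1 h2
    rw [h1, gramSchmidt₂_eq (a := ‖e w‖ ^ 2) (by positivity) (by simp [N, dualInner_self])]
    simp [N, σ, g, q]
  have horth : ∀ᶠ w in 𝓝 p, N w 0 0 * σ w 0 + N w 0 1 * σ w 1 = 0 := by
    filter_upwards [he.continuousAt.eventually_ne he0] with w h2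
    have h3 := dualInner_self_ne_zero h2
    simp [N, σ, q]
    field_simp
    ring
  have hdet : IsUnit (N p).det := by
    rw [isUnit_iff_ne_zero, Matrix.det_fin_two]
    have h1 : g p ≠ 0 := by
      rw [hgp]; exact mul_ne_zero h00 hpos
    have h2 : N p 0 0 * N p 1 1 - N p 0 1 * N p 1 0 = dualInner (e p) (e p) * g p := by
      simp [N, g]
      field_simp
    rw [h2]
    exact mul_ne_zero h00 h1
  have hNp : jetMetric ν h p = N p := hN.self_of_nhds
  have hchern : chernD (jetMetric ν h) (fun w => gramSchmidt₂ (jetMetric ν h w)) p v =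
      chernD N σ p v := by
    have h1 : (fun w => gramSchmidt₂ (jetMetric ν h w)) =ᶠ[𝓝 p] σ := hgs
    have h2 : ∀ i j, (fun w => jetMetric ν h w i j) =ᶠ[𝓝 p] fun w => N w i j := fun i j =>
      hN.mono fun w hw => by simp only [hw]
    simp only [chernD]
    rw [h1.dHol_eq, h1.dBar_eq, hgs.self_of_nhds, hNp]
    simp only [fun i j => (h2 i j).dHol_eq v]
  rw [secondFundamentalForm, hchern, hNp, gramSchmidt₁_eq, fiberInner_smul_fst,
    mulVec_chernD_of_orthogonal (fun j => by fin_cases j <;> simpa [N]) hσ hdet horth]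
  have hb0 : dBar (fun w => N w 0 0) p v = dualInner (e p) (fderiv ℂ e p v) := by
    simpa [N] using dBar_dualInner hedd hedd v
  have hb1 : dBar (fun w => N w 0 1) p v = dualInner (A p) (fderiv ℂ e p v) := by
    simpa [N] using dBar_dualInner hAdd hedd v
  rw [hb0, hb1]
  have hnorm : 0 < ‖e p‖ := norm_pos_iff.mpr he0
  have hsqrt0 : Real.sqrt (N p 0 0).re = ‖e p‖ := by
    have : (N p 0 0).re = ‖e p‖ ^ 2 := by
      simp only [N, Matrix.of_apply, Matrix.cons_val_zero, dualInner_self, Complex.ofReal_re]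
    rw [this, Real.sqrt_sq hnorm.le]
  have hsqrt1 : Real.sqrt (g p).re =
      ‖e p‖ * Real.sqrt (polarCurvature e p p (ν p) (ν p)).re := by
    rw [hgp, dualInner_self, Complex.re_ofReal_mul, Real.sqrt_mul (by positivity),
      Real.sqrt_sq hnorm.le]
  have hn0 : ((‖e p‖ : ℝ) : ℂ) ≠ 0 := by exact_mod_cast hnorm.ne'
  have hK : dualInner (e p) (e p) = (‖e p‖ : ℂ) * ‖e p‖ := by
    rw [dualInner_self]; push_cast; ring
  rw [hsqrt0]
  have hσ0 : σ p 0 = (((Real.sqrt (g p).re : ℝ) : ℂ)⁻¹) * -q p := by simp [σ]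
  have hσ1 : σ p 1 = (((Real.sqrt (g p).re : ℝ) : ℂ)⁻¹) := by simp [σ]
  rw [hσ0, hσ1, hsqrt1]
  have hr0 : ((Real.sqrt (polarCurvature e p p (ν p) (ν p)).re : ℝ) : ℂ) ≠ 0 := by
    have h1 : Real.sqrt (g p).re ≠ 0 := (Real.sqrt_pos.mpr hgpos).ne'
    rw [hsqrt1] at h1
    exact_mod_cast right_ne_zero_of_mul h1
  generalize Real.sqrt (polarCurvature e p p (ν p) (ν p)).re = r at hr0 ⊢
  simp only [polarCurvature, q, hK, A]
  rw [map_inv₀, Complex.conj_ofReal]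
  push_cast
  field_simp
  ring

end SecondFundamentalForm

/-! ### Definiteness of the curvature and the tangent–normal splitting -/

namespace QuasiFree

variable {m : ℕ} {Ω Z : Set (EuclideanSpace ℂ (Fin m))}
  {H : Type*} [NormedAddCommGroup H] [InnerProductSpace ℂ H] [CompleteSpace H]

theorem curvature_metric (M : QuasiFree Ω H) (hΩ : IsOpen Ω) (hΩb : Bornology.IsBounded Ω)
    {p : EuclideanSpace ℂ (Fin m)} (hp : p ∈ Ω) (u v : EuclideanSpace ℂ (Fin m)) :
    curvature M.metric p u v = polarCurvature M.eval p p v u := by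
  rw [metric_eq]
  exact curvature_dualInner (M.analyticOnNhd_eval hΩ hΩb p hp) (M.eval_ne_zero hp) u v

/-- The curvature of the bundle of a quasi-free module is definite. -/
theorem polarCurvature_self_ne_zero (M : QuasiFree Ω H) (hΩ : IsOpen Ω)
    (hΩb : Bornology.IsBounded Ω) {p : EuclideanSpace ℂ (Fin m)} (hp : p ∈ Ω)
    {v : EuclideanSpace ℂ (Fin m)} (hv : v ≠ 0) : polarCurvature M.eval p p v v ≠ 0 := by
  have he0 := M.eval_ne_zero hp
  rw [polarCurvature_self_eq he0]
  norm_cast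
  refine div_ne_zero (pow_ne_zero 2 (norm_ne_zero_iff.mpr fun h => ?_))
    (pow_ne_zero 2 (norm_ne_zero_iff.mpr he0))
  set c := dualInner (fderiv ℂ M.eval p v) (M.eval p) / dualInner (M.eval p) (M.eval p)
  have h1 : ∀ f : AlgA Ω, fderiv ℂ (fun z => evalA Ω z f) p v = c * evalA Ω p f := by
    intro f
    rw [← M.fderiv_eval_emb hΩ hΩb hp, sub_eq_zero.mp h, ← M.eval_emb hp]
    rfl
  have hmem : ∀ᶠ z in 𝓝 p, z ∈ closure Ω := by
    filter_upwards [hΩ.mem_nhds hp] with z hz using subset_closure hz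
  have hone : (fun z => evalA Ω z 1) =ᶠ[𝓝 p] fun _ => (1 : ℂ) :=
    hmem.mono fun z hz => evalA_one hz
  -- If `∂_v e` were `c` times `e`, then `∂_v f = c f` at `p` for all `f` in the algebra: `f = 1`
  -- forces `c = 0`, and a linear function with `ℓ v ≠ 0` contradicts this.
  have hc : c = 0 := by
    have h2 := h1 1
    rw [hone.fderiv_eq, evalA_one (subset_closure hp)] at h2
    simpa using h2.symm
  obtain ⟨ℓ, hℓ⟩ : ∃ ℓ : StrongDual ℂ (EuclideanSpace ℂ (Fin m)), ℓ v ≠ 0 :=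
    ⟨innerSL ℂ v, by simpa using hv⟩
  have hlin : (fun z => evalA Ω z (AlgA.ofDual Ω ℓ)) =ᶠ[𝓝 p] ℓ :=
    hmem.mono fun z hz => evalA_ofDual hz ℓ
  have h3 := h1 (AlgA.ofDual Ω ℓ)
  rw [hlin.fderiv_eq, hc, zero_mul, ℓ.fderiv] at h3
  exact hℓ h3

end QuasiFree

theorem exists_tangent_add_smul {m : ℕ} {Ω Z : Set (EuclideanSpace ℂ (Fin m))}
    (hZ : IsHypersurface Ω Z) {p : EuclideanSpace ℂ (Fin m)} (hp : p ∈ Z)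
    {n : EuclideanSpace ℂ (Fin m)} (hn : n ∉ tangentZ Ω Z p) (v : EuclideanSpace ℂ (Fin m)) :
    ∃ t ∈ tangentZ Ω Z p, ∃ c : ℂ, v = t + c • n := by
  obtain ⟨U, φ, hφ, hpU⟩ := hZ.2 p hp
  rw [hφ.mem_tangentZ_iff hpU hp] at hn
  refine ⟨v - (fderiv ℂ φ p v / fderiv ℂ φ p n) • n, ?_, fderiv ℂ φ p v / fderiv ℂ φ p n,
    by abel⟩
  rw [hφ.mem_tangentZ_iff hpU hp, map_sub, map_smul, smul_eq_mul, div_mul_cancel₀ _ hn, sub_self]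

end

/-! ### The main theorem -/

theorem theorem2 {m : ℕ} {Ω Z : Set (EuclideanSpace ℂ (Fin m))}
    (hΩ : IsOpen Ω) (hΩc : IsConnected Ω) (hΩb : Bornology.IsBounded Ω)
    (hZ : IsHypersurface Ω Z) (hZc : IsConnected Z)
    {H H' : Type*} [NormedAddCommGroup H] [InnerProductSpace ℂ H] [CompleteSpace H]
    [NormedAddCommGroup H'] [InnerProductSpace ℂ H'] [CompleteSpace H']
    (M : QuasiFree Ω H) (M' : QuasiFree Ω H')
    -- near each `p ∈ Z`, a holomorphic vector field `ν p` transverse to `Z`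
    (ν : EuclideanSpace ℂ (Fin m) → EuclideanSpace ℂ (Fin m) → EuclideanSpace ℂ (Fin m))
    (hν : ∀ p ∈ Z, AnalyticAt ℂ (ν p) p ∧ ν p p ∉ tangentZ Ω Z p) :
    (M.QuotIso M' Z ↔ ∀ p ∈ Z,
      curvTan Ω Z M.metric p = curvTan Ω Z M'.metric p ∧
      curvTrans M.metric p (ν p p) = curvTrans M'.metric p (ν p p) ∧
      curvOff Ω Z M.metric p (ν p p) = curvOff Ω Z M'.metric p (ν p p)) ∧
    (M.QuotIso M' Z ↔ ∀ p ∈ Z,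
      curvTan Ω Z M.metric p = curvTan Ω Z M'.metric p ∧
      curvTrans M.metric p (ν p p) = curvTrans M'.metric p (ν p p) ∧
      secondFundamentalForm (ν p) M.metric p = secondFundamentalForm (ν p) M'.metric p) := by
  have hcurv := fun p (hp : p ∈ Z) => M.curvature_metric hΩ hΩb (hZ.1 hp)
  have hcurv' := fun p (hp : p ∈ Z) => M'.curvature_metric hΩ hΩb (hZ.1 hp)
  have hν0 : ∀ p ∈ Z, ν p p ≠ 0 := fun p hp h =>
    (hν p hp).2 (by rw [h]; exact zero_mem _)
  have hnz := fun p (hp : p ∈ Z) => M.polarCurvature_self_ne_zero hΩ hΩb (hZ.1 hp) (hν0 p hp)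
  have hnz' := fun p (hp : p ∈ Z) => M'.polarCurvature_self_ne_zero hΩ hΩb (hZ.1 hp) (hν0 p hp)
  have hII := fun p (hp : p ∈ Z) v => secondFundamentalForm_eq
    (M.analyticOnNhd_eval hΩ hΩb p (hZ.1 hp)) (hν p hp).1 (M.eval_ne_zero (hZ.1 hp)) (hnz p hp) v
  have hII' := fun p (hp : p ∈ Z) v => secondFundamentalForm_eq
    (M'.analyticOnNhd_eval hΩ hΩb p (hZ.1 hp)) (hν p hp).1 (M'.eval_ne_zero (hZ.1 hp))
    (hnz' p hp) v
  simp only [← QuasiFree.metric_eq] at hII hII'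
  have hfwd : M.QuotIso M' Z → ∀ p ∈ Z, ∀ v u,
      polarCurvature M.eval p p v u = polarCurvature M'.eval p p v u :=
    fun h p hp v u => M.polarCurvature_eq_of_quotIso M' hΩ hΩb hZ h hp v u
  -- Common form of both sufficiency claims: with either `𝒮` or `𝕀`, what remains to be known is the
  -- curvature between tangent vectors and `ν`.
  have hbwd : (∀ p ∈ Z, curvTan Ω Z M.metric p = curvTan Ω Z M'.metric p ∧
      curvTrans M.metric p (ν p p) = curvTrans M'.metric p (ν p p) ∧
      ∀ t ∈ tangentZ Ω Z p, polarCurvature M.eval p p t (ν p p) =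
        polarCurvature M'.eval p p t (ν p p)) → M.QuotIso M' Z := by
    intro h
    refine M.quotIso_of_polarCurvature_eq M' hΩ hΩb hZ hZc fun p hp v u => ?_
    obtain ⟨h1, h2, h3⟩ := h p hp
    rw [curvTrans, curvTrans, hcurv p hp, hcurv' p hp] at h2
    obtain ⟨t, ht, c, rfl⟩ := exists_tangent_add_smul hZ hp (hν p hp).2 v
    obtain ⟨s, hs, d, rfl⟩ := exists_tangent_add_smul hZ hp (hν p hp).2 u
    have h4 : polarCurvature M.eval p p t s = polarCurvature M'.eval p p t s := by
      have := congrFun (congrFun h1 ⟨s, hs⟩) ⟨t, ht⟩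
      rwa [curvTan, curvTan, hcurv p hp, hcurv' p hp] at this
    have h5 : polarCurvature M.eval p p (ν p p) s = polarCurvature M'.eval p p (ν p p) s := by
      rw [← polarCurvature_conj, h3 s hs, polarCurvature_conj]
    simp only [polarCurvature_add_left, polarCurvature_add_right, polarCurvature_smul_left,
      polarCurvature_smul_right, h2, h3 t ht, h4, h5]
  have htan : M.QuotIso M' Z → ∀ p ∈ Z, curvTan Ω Z M.metric p = curvTan Ω Z M'.metric p := by
    intro h p hp
    funext u v
    rw [curvTan, curvTan, hcurv p hp, hcurv' p hp, hfwd h p hp]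
  have htrans : M.QuotIso M' Z → ∀ p ∈ Z,
      curvTrans M.metric p (ν p p) = curvTrans M'.metric p (ν p p) := by
    intro h p hp
    rw [curvTrans, curvTrans, hcurv p hp, hcurv' p hp, hfwd h p hp]
  refine ⟨⟨fun h p hp => ⟨htan h p hp, htrans h p hp, ?_⟩, fun h => hbwd fun p hp => ?_⟩,
    ⟨fun h p hp => ⟨htan h p hp, htrans h p hp, ?_⟩, fun h => hbwd fun p hp => ?_⟩⟩
  · funext v
    rw [curvOff, curvOff, hcurv p hp, hcurv' p hp, hfwd h p hp]
  · obtain ⟨h1, h2, h3⟩ := h p hp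
    refine ⟨h1, h2, fun t ht => ?_⟩
    have := congrFun h3 ⟨t, ht⟩
    rwa [curvOff, curvOff, hcurv p hp, hcurv' p hp] at this
  · funext v
    rw [hII p hp, hII' p hp, hfwd h p hp, hfwd h p hp]
  · obtain ⟨h1, h2, h3⟩ := h p hp
    refine ⟨h1, h2, fun t ht => ?_⟩
    rw [curvTrans, curvTrans, hcurv p hp, hcurv' p hp] at h2
    have h4 := congrFun h3 t
    rw [hII p hp, hII' p hp, ← h2] at h4
    -- The transverse curvatures agree, so both second fundamental forms carry the same factor,
    -- which is nonzero and cancels.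
    have hr : (-((Real.sqrt (polarCurvature M.eval p p (ν p p) (ν p p)).re : ℝ) : ℂ)⁻¹) ≠ 0 := by
      refine neg_ne_zero.mpr (inv_ne_zero ?_)
      have h5 := hnz p hp
      rw [polarCurvature_self_eq (M.eval_ne_zero (hZ.1 hp))] at h5 ⊢
      rw [Complex.ofReal_re]
      have h6 := Complex.ofReal_ne_zero.mp h5
      exact Complex.ofReal_ne_zero.mpr
        (Real.sqrt_pos.mpr (lt_of_le_of_ne (by positivity) h6.symm)).ne'
    have h7 := mul_left_cancel₀ hr h4
    rw [← polarCurvature_conj, h7, polarCurvature_conj]
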